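/- Let $d\ge 1$, let $\langle\cdot,\cdot\rangle$ and $\|\cdot\|$ be the Euclidean scalar product and norm on $\mathbb{R}^d$, and for $u,v\in L^2(\mathbb{R}^d)$ (complex-valued) define the radar ambiguity function $$A(u,v)(x,y)=\int_{\mathbb{R}^d}u\left(t+\frac{x}{2}\right)\overline{v\left(t-\frac{x}{2}\right)}\,e^{-2i\pi\langle y,t\rangle}\,dt,\qquad x,y\in\mathbb{R}^d.$$ Theorem. Let $N\in\mathbb{R}$ and let $u,v\in L^2(\mathbb{R}^d)$, neither of which vanishes almost everywhere. Suppose that $$\iint_{\mathbb{R}^{2d}}|A(u,v)(x,y)|^2\,\frac{e^{\pi\|x\|^2}}{(1+\|x\|)^N}\,dx\,dy<+\infty\quad\text{and}\quad\iint_{\mathbb{R}^{2d}}|A(u,v)(x,y)|^2\,\frac{e^{\pi\|y\|^2}}{(1+\|y\|)^N}\,dx\,dy<+\infty.$$ Then there exist $a,w\in\mathbb{R}^d$ and polynomials $P,Q$ in $d$ variables with complex coefficients such that, for almost every $x\in\mathbb{R}^d$, $$u(x)=P(x)\,e^{2i\pi\langle w,x\rangle}e^{-\pi\|x-a\|^2}\quad\text{and}\quad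 v(x)=Q(x)\,e^{2i\pi\langle w,x\rangle}e^{-\pi\|x-a\|^2}.$$ -/

import Mathlib

open MeasureTheory
open scoped ENNReal ComplexConjugate InnerProductSpace

/-- The radar ambiguity function
`A(u,v)(x,y) = ∫ u(t + x/2) * conj (v(t - x/2)) * exp(-2iπ⟨y,t⟩) dt` on `ℝ^d`. -/
noncomputable def radarAmbiguity {d : ℕ} (u v : EuclideanSpace ℝ (Fin d) → ℂ)
    (x y : EuclideanSpace ℝ (Fin d)) : ℂ :=
  ∫ t : EuclideanSpace ℝ (Fin d),
    u (t + (1 / 2 : ℝ) • x) * conj (v (t - (1 / 2 : ℝ) • x)) *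
      Complex.exp (-2 * Complex.I * (Real.pi : ℂ) * ((⟪y, t⟫_ℝ : ℝ) : ℂ))

/-- The function `x ↦ P(x) * exp(2iπ⟨w,x⟩) * exp(-π‖x - a‖²)` on `ℝ^d`,
for a polynomial `P` in `d` variables with complex coefficients. -/
noncomputable def polyGaussian {d : ℕ} (P : MvPolynomial (Fin d) ℂ)
    (w a x : EuclideanSpace ℝ (Fin d)) : ℂ :=
  MvPolynomial.eval (fun i => ((x i : ℝ) : ℂ)) P *
    Complex.exp (2 * Complex.I * (Real.pi : ℂ) * ((⟪w, x⟫_ℝ : ℝ) : ℂ)) *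
      ((Real.exp (-Real.pi * ‖x - a‖ ^ 2) : ℝ) : ℂ)

/-! The double integral of `|A(u,v)|²` against a weight in `x` alone is, by Plancherel in `y`, the
integral of `|u(s)|²|v(r)|²` against the same weight at `s - r`; a weight in `y` gives the same
formula for the Fourier transforms of `u` and `v`. The hypotheses thus become a coupled Hardy
condition on the pair `(u, v)` and on the pair of transforms. Freezing one variable already gives
each of the four functions some Gaussian decay, so they are integrable and Fourier inversion
applies.

Fix a unit vector `e` and points `s, t`. The decay of the transforms makes `Φ(τ) = u(s + τe) v(t -
τe)` entire with `|Φ(τ)| ≤ C (1 + (Im τ)²)^M exp(2π (Im τ)²)` (`exists_integral_prod_mul_exp_le`,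
`norm_fourierExt_mul_le`). For almost every `(s, t)` the condition on `u, v` makes `Φ` square
integrable on the real line against a Gaussian weight centred at `-c/2`, where `c = ⟨s - t, e⟩`.
Multiplying by `exp((π/2)(2τ + c)²)` balances both Gaussians exactly, and a Phragmén–Lindelöf
argument at the critical order leaves a polynomial whose degree is bounded independently of `(s, t)`
(`hardy_iteratedDeriv_eq_zero`, `hardy_slices`).

With `f = u exp(π|·|²)` and `g = v exp(π|·|²)`, this says that `σ ↦ f(s + σe) g(t - σe)` is a
polynomial, i.e. `(D ⊗ 1 - 1 ⊗ D)^n (f ⊗ g) = 0` for the derivative `D` along `e`. Linear algebra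
then gives one `μ` with `(D - μ)^n f = (D - μ)^n g = 0` (`exists_generalized_eigenvalue`). Doing
this along each coordinate axis makes `f` and `g` polynomials times the common exponential `exp(∑ μᵢ
sᵢ)` (`exists_mvPolynomial_of_generalized_eigen`). The real and imaginary parts of `μ` are `2πa` and
`2πw`. -/

open FourierTransform

/-! ### Plancherel and Fourier inversion for integrable functions -/

section Plancherel

variable {V : Type*} [NormedAddCommGroup V] [InnerProductSpace ℝ V] [FiniteDimensional ℝ V]
  [MeasurableSpace V] [BorelSpace V]

theorem ae_eq_of_forall_schwartz {f g : V → ℂ} (hf : LocallyIntegrable f)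
    (hg : LocallyIntegrable g)
    (h : ∀ φ : SchwartzMap V ℂ, ∫ x, φ x * f x = ∫ x, φ x * g x) : f =ᵐ[volume] g := by
  refine ae_eq_of_integral_contDiff_smul_eq hf hg fun φ hφ hφc => ?_
  have h1 : ContDiff ℝ (⊤ : ℕ∞) (fun x => (φ x : ℂ)) := Complex.ofRealCLM.contDiff.comp hφ
  have h2 : HasCompactSupport (fun x => (φ x : ℂ)) := hφc.comp_left (g := fun r : ℝ => (r : ℂ)) rfl
  simpa using h (h2.toSchwartzMap h1)

theorem integral_schwartz_mul_fourier {h : V → ℂ} (hh : Integrable h) (φ : SchwartzMap V ℂ) :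
    ∫ x, φ x * 𝓕 h x = ∫ x, (𝓕 φ) x * h x := by
  have := VectorFourier.integral_fourierIntegral_smul_eq_flip (μ := (volume : Measure V))
    (ν := (volume : Measure V)) (e := Real.fourierChar) (L := innerₗ V) Real.continuous_fourierChar
    continuous_inner φ.integrable hh
  rw [flip_innerₗ] at this
  exact this.symm

theorem lintegral_sq_eq_of_ae_eq_Lp {f : V → ℂ} {F : Lp ℂ 2 (volume : Measure V)} (h : F =ᵐ[volume] f) :
    ∫⁻ x, ‖f x‖ₑ ^ 2 = ‖F‖ₑ ^ 2 := by
  have h1 : ∫⁻ x, ‖f x‖ₑ ^ 2 = ∫⁻ x, ‖F x‖ₑ ^ 2 :=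
    lintegral_congr_ae (h.mono fun x hx => by simp only [hx])
  rw [h1, Lp.enorm_def, eLpNorm_eq_lintegral_rpow_enorm_toReal (by norm_num) (by norm_num)]
  simp only [ENNReal.toReal_ofNat, ENNReal.rpow_ofNat]
  rw [← ENNReal.rpow_natCast, ← ENNReal.rpow_mul]
  norm_num

theorem memLp_two_of_lintegral_sq {f : V → ℂ} (hf : AEStronglyMeasurable f)
    (h : ∫⁻ x, ‖f x‖ₑ ^ 2 ≠ ∞) : MemLp f 2 := by
  refine ⟨hf, ?_⟩
  rw [eLpNorm_eq_lintegral_rpow_enorm_toReal (by norm_num) (by norm_num)]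
  simp only [ENNReal.toReal_ofNat, ENNReal.rpow_ofNat]
  exact ENNReal.rpow_lt_top_of_nonneg (by norm_num) h

theorem lintegral_sq_ne_top_of_memLp_two {f : V → ℂ} (hf : MemLp f 2) :
    ∫⁻ x, ‖f x‖ₑ ^ 2 ≠ ∞ := by
  rw [lintegral_sq_eq_of_ae_eq_Lp hf.coeFn_toLp, Lp.enorm_toLp]
  exact ENNReal.pow_ne_top hf.eLpNorm_ne_top

theorem continuous_fourier_of_integrable {h : V → ℂ} (hh : Integrable h) : Continuous (𝓕 h) :=
  VectorFourier.fourierIntegral_continuous Real.continuous_fourierChar continuous_inner hh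

theorem lintegral_fourier_sq_of_memLp_two {h : V → ℂ} (hh : Integrable h) (h2 : MemLp h 2) :
    ∫⁻ x, ‖𝓕 h x‖ₑ ^ 2 = ∫⁻ x, ‖h x‖ₑ ^ 2 := by
  have key : (𝓕 (h2.toLp h) : Lp ℂ 2 (volume : Measure V)) =ᵐ[volume] 𝓕 h := by
    refine ae_eq_of_forall_schwartz ((Lp.memLp _).locallyIntegrable (by norm_num))
      (continuous_fourier_of_integrable hh).locallyIntegrable fun φ => ?_
    have e := congrArg (fun T => T φ) (Lp.fourier_toTemperedDistribution_eq (h2.toLp h))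
    simp only [TemperedDistribution.fourier_apply, Lp.toTemperedDistribution_apply,
      smul_eq_mul] at e
    rw [← e, integral_schwartz_mul_fourier hh]
    exact integral_congr_ae (h2.coeFn_toLp.mono fun x hx => by simp only [hx])
  rw [lintegral_sq_eq_of_ae_eq_Lp key, lintegral_sq_eq_of_ae_eq_Lp h2.coeFn_toLp,
    ← ofReal_norm, ← ofReal_norm, Lp.norm_fourier_eq]

/-- Both sides may be infinite: a product of two `L²` functions is only integrable. If the transform
were in `L²` and `h` were not, the `L²` inverse transform would agree with `h` when tested against
Schwartz functions, a contradiction. -/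
theorem lintegral_fourier_sq {h : V → ℂ} (hh : Integrable h) :
    ∫⁻ x, ‖𝓕 h x‖ₑ ^ 2 = ∫⁻ x, ‖h x‖ₑ ^ 2 := by
  by_cases h2 : ∫⁻ x, ‖h x‖ₑ ^ 2 = ∞
  · by_contra hne
    rw [h2] at hne
    have hF : MemLp (𝓕 h) 2 := memLp_two_of_lintegral_sq
      (continuous_fourier_of_integrable hh).aestronglyMeasurable hne
    have key : (𝓕⁻ (hF.toLp (𝓕 h)) : Lp ℂ 2 (volume : Measure V)) =ᵐ[volume] h := by
      refine ae_eq_of_forall_schwartz ((Lp.memLp _).locallyIntegrable (by norm_num))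
        hh.locallyIntegrable fun φ => ?_
      have e := congrArg (fun T => T φ) (Lp.fourierInv_toTemperedDistribution_eq (hF.toLp (𝓕 h)))
      simp only [TemperedDistribution.fourierInv_apply, Lp.toTemperedDistribution_apply,
        smul_eq_mul] at e
      rw [← e]
      trans ∫ x, (𝓕⁻ φ) x * 𝓕 h x
      · exact integral_congr_ae (hF.coeFn_toLp.mono fun x hx => by simp only [hx])
      · rw [integral_schwartz_mul_fourier hh, fourier_fourierInv_eq]
    refine lintegral_sq_ne_top_of_memLp_two ?_ h2
    exact (Lp.memLp _).ae_eq key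
  · exact lintegral_fourier_sq_of_memLp_two hh (memLp_two_of_lintegral_sq hh.1 h2)

theorem ae_eq_fourierInv_fourier {h : V → ℂ} (hh : Integrable h) (hF : Integrable (𝓕 h)) :
    h =ᵐ[volume] 𝓕⁻ (𝓕 h) := by
  have hcont : Continuous (𝓕⁻ (𝓕 h)) := by
    have : 𝓕⁻ (𝓕 h) = fun x => 𝓕 (𝓕 h) (-x) := by
      ext x; exact Real.fourierInv_eq_fourier_neg _ _
    rw [this]
    exact (continuous_fourier_of_integrable hF).comp continuous_neg
  refine ae_eq_of_forall_schwartz hh.locallyIntegrable hcont.locallyIntegrable fun φ => ?_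
  have e1 : ∫ x, φ x * 𝓕⁻ (𝓕 h) x = ∫ x, φ (-x) * 𝓕 (𝓕 h) x := by
    rw [← integral_neg_eq_self]
    simp only [Real.fourierInv_eq_fourier_neg, neg_neg]
  have e2 : ∫ x, φ (-x) * 𝓕 (𝓕 h) x = ∫ x, (𝓕⁻ φ) x * 𝓕 h x := by
    have := VectorFourier.integral_fourierIntegral_smul_eq_flip (μ := (volume : Measure V))
      (ν := (volume : Measure V)) (e := Real.fourierChar) (L := innerₗ V)
      Real.continuous_fourierChar continuous_inner φ.integrable.comp_neg hF
    rw [flip_innerₗ] at this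
    refine this.symm.trans (integral_congr_ae (.of_forall fun x => ?_))
    change (𝓕 (fun x => φ (-x)) x) * _ = _
    rw [SchwartzMap.fourierInv_coe, Real.fourierInv_eq_fourier_comp_neg]
  rw [e1, e2, integral_schwartz_mul_fourier hh, fourier_fourierInv_eq]

end Plancherel

/-! ### Weighted integrals of the ambiguity function -/

section Radar

variable {d : ℕ}

local notation "𝔼" => EuclideanSpace ℝ (Fin d)

theorem radarAmbiguity_congr_ae {u u' v v' : 𝔼 → ℂ} (hu : u =ᵐ[volume] u')
    (hv : v =ᵐ[volume] v') : radarAmbiguity u v = radarAmbiguity u' v' := by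
  ext x y
  refine integral_congr_ae ?_
  filter_upwards [(measurePreserving_add_right volume ((1 / 2 : ℝ) • x)).quasiMeasurePreserving.ae
    hu, (measurePreserving_sub_right volume ((1 / 2 : ℝ) • x)).quasiMeasurePreserving.ae hv]
    with t h1 h2
  rw [h1, h2]

theorem measurable_radarAmbiguity {u v : 𝔼 → ℂ} (hu : Measurable u) (hv : Measurable v) :
    Measurable fun p : 𝔼 × 𝔼 => radarAmbiguity u v p.1 p.2 := by
  refine StronglyMeasurable.measurable (StronglyMeasurable.integral_prod_right
    (f := fun (p : 𝔼 × 𝔼) (t : 𝔼) => u (t + (1 / 2 : ℝ) • p.1) *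
      conj (v (t - (1 / 2 : ℝ) • p.1)) *
      Complex.exp (-2 * Complex.I * (Real.pi : ℂ) * ((⟪p.2, t⟫_ℝ : ℝ) : ℂ))) ?_)
  refine Measurable.stronglyMeasurable ?_
  have h1 : Measurable fun q : (𝔼 × 𝔼) × 𝔼 => u (q.2 + (1 / 2 : ℝ) • q.1.1) :=
    hu.comp (by fun_prop)
  have h2 : Measurable fun q : (𝔼 × 𝔼) × 𝔼 => conj (v (q.2 - (1 / 2 : ℝ) • q.1.1)) :=
    Complex.continuous_conj.measurable.comp (hv.comp (by fun_prop))
  have h3 : Measurable fun q : (𝔼 × 𝔼) × 𝔼 =>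
      Complex.exp (-2 * Complex.I * (Real.pi : ℂ) * ((⟪q.1.2, q.2⟫_ℝ : ℝ) : ℂ)) :=
    Continuous.measurable (by fun_prop)
  exact (h1.mul h2).mul h3

theorem fourierChar_eq_exp (r : ℝ) :
    (Real.fourierChar (-r) : ℂ) = Complex.exp (-2 * Complex.I * (Real.pi : ℂ) * (r : ℂ)) := by
  rw [Real.fourierChar_apply]
  push_cast
  ring_nf

theorem radarAmbiguity_eq_fourier (u v : 𝔼 → ℂ) (x y : 𝔼) :
    radarAmbiguity u v x y =
      𝓕 (fun t => u (t + (1 / 2 : ℝ) • x) * conj (v (t - (1 / 2 : ℝ) • x))) y := by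
  rw [Real.fourier_eq]
  refine integral_congr_ae (.of_forall fun t => ?_)
  simp only [Circle.smul_def, fourierChar_eq_exp, smul_eq_mul, real_inner_comm]
  ring

theorem integrable_mul_conj_shift {u v : 𝔼 → ℂ} (hu : MemLp u 2) (hv : MemLp v 2) (x : 𝔼) :
    Integrable fun t => u (t + (1 / 2 : ℝ) • x) * conj (v (t - (1 / 2 : ℝ) • x)) :=
  (hu.comp_measurePreserving (measurePreserving_add_right volume ((1 / 2 : ℝ) • x))).integrable_mul
    (hv.comp_measurePreserving (measurePreserving_sub_right volume ((1 / 2 : ℝ) • x))).star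

theorem lintegral_lintegral_shear {V : Type*} [NormedAddCommGroup V] [MeasurableSpace V]
    [BorelSpace V] [SecondCountableTopology V] (μ : Measure V) [SFinite μ] [μ.IsAddRightInvariant]
    {ω F G : V → ℝ≥0∞}
    (hω : Measurable ω) (hF : Measurable F) (hG : Measurable G) :
    ∫⁻ x, ω x * ∫⁻ r, F (r + x) * G r ∂μ ∂μ = ∫⁻ r, ∫⁻ s, F s * G r * ω (s - r) ∂μ ∂μ := by
  have h1 : ∀ x, ω x * ∫⁻ r, F (r + x) * G r ∂μ = ∫⁻ r, F (x + r) * G r * ω (x + r - r) ∂μ := by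
    intro x
    rw [← lintegral_const_mul _ (by fun_prop)]
    refine lintegral_congr fun r => ?_
    rw [add_sub_cancel_right, add_comm x r]
    ring
  simp_rw [h1]
  rw [lintegral_lintegral_swap (by fun_prop)]
  exact lintegral_congr fun r =>
    lintegral_add_right_eq_self (μ := μ) (fun s => F s * G r * ω (s - r)) r

/-- For fixed `x`, the ambiguity function is a Fourier transform in `y`, so Plancherel removes `y`;
the shear `s = r + x` does the rest. -/
theorem lintegral_radarAmbiguity_weight_left {u v : 𝔼 → ℂ} (hu : MemLp u 2) (hv : MemLp v 2)
    (hum : Measurable u) (hvm : Measurable v) {ω : 𝔼 → ℝ≥0∞} (hω : Measurable ω) :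
    ∫⁻ p : 𝔼 × 𝔼, ‖radarAmbiguity u v p.1 p.2‖ₑ ^ 2 * ω p.1 =
      ∫⁻ r, ∫⁻ s, ‖u s‖ₑ ^ 2 * ‖v r‖ₑ ^ 2 * ω (s - r) := by
  rw [← lintegral_lintegral_shear volume hω (hum.enorm.pow_const 2) (hvm.enorm.pow_const 2)]
  have hA := measurable_radarAmbiguity hum hvm
  rw [Measure.volume_eq_prod, lintegral_prod _ (by fun_prop)]
  refine lintegral_congr fun x => ?_
  have hAx : Measurable fun y => ‖radarAmbiguity u v x y‖ₑ ^ 2 :=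
    (hA.comp measurable_prodMk_left).enorm.pow_const 2
  dsimp only
  rw [lintegral_mul_const _ hAx, mul_comm]
  congr 1
  simp_rw [radarAmbiguity_eq_fourier]
  rw [lintegral_fourier_sq (integrable_mul_conj_shift hu hv x)]
  rw [← lintegral_add_right_eq_self _ ((1 / 2 : ℝ) • x)]
  refine lintegral_congr fun r => ?_
  have e : r + (1 / 2 : ℝ) • x + (1 / 2 : ℝ) • x = r + x := by
    rw [add_assoc, ← add_smul]; norm_num
  rw [e, add_sub_cancel_right, enorm_mul, mul_pow, RCLike.enorm_conj]

theorem fourier_mul_fourierChar (u : 𝔼 → ℂ) (y ω : 𝔼) :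
    𝓕 (fun s => (Real.fourierChar (-⟪y, s⟫_ℝ) : ℂ) * u s) ω = 𝓕 u (ω + y) := by
  rw [Real.fourier_eq, Real.fourier_eq]
  refine integral_congr_ae (.of_forall fun s => ?_)
  simp only [Circle.smul_def, smul_eq_mul, fourierChar_eq_exp, ← mul_assoc, ← Complex.exp_add]
  rw [inner_add_right, real_inner_comm s y]
  push_cast
  ring_nf

theorem fourier_conj_comp_neg (v : 𝔼 → ℂ) (ω : 𝔼) :
    𝓕 (fun s => conj (v (-s))) ω = conj (𝓕 v ω) := by
  rw [Real.fourier_eq, Real.fourier_eq, ← integral_neg_eq_self, ← integral_conj]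
  refine integral_congr_ae (.of_forall fun s => ?_)
  simp only [Circle.smul_def, smul_eq_mul, fourierChar_eq_exp, map_mul, ← Complex.exp_conj, neg_neg,
    Complex.conj_ofReal, inner_neg_left, Complex.conj_I, map_neg, map_ofNat]
  rw [← neg_neg ⟪s, ω⟫_ℝ, fourierChar_eq_exp]
  push_cast
  ring_nf

open Convolution in
-- Up to a unimodular factor, `A(u,v)(·, y)` is a convolution of a modulation of `u` with the
-- reflected conjugate of `v`. Its Fourier transform in `x` is therefore a product, which is what
-- Plancherel in `x` needs.
theorem enorm_radarAmbiguity_eq_convolution (u v : 𝔼 → ℂ) (x y : 𝔼) :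
    ‖radarAmbiguity u v x y‖ₑ = ‖((fun s => (Real.fourierChar (-⟪y, s⟫_ℝ) : ℂ) * u s)
      ⋆[ContinuousLinearMap.mul ℂ ℂ, volume] fun s => conj (v (-s))) x‖ₑ := by
  have : radarAmbiguity u v x y = (Real.fourierChar (-⟪y, -(1 / 2 : ℝ) • x⟫_ℝ) : ℂ) *
      ((fun s => (Real.fourierChar (-⟪y, s⟫_ℝ) : ℂ) * u s)
      ⋆[ContinuousLinearMap.mul ℂ ℂ, volume] fun s => conj (v (-s))) x := by
    rw [convolution_def, radarAmbiguity, ← integral_sub_right_eq_self _ ((1 / 2 : ℝ) • x),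
      ← integral_const_mul]
    refine integral_congr_ae (.of_forall fun s => ?_)
    have e : s - (1 / 2 : ℝ) • x - (1 / 2 : ℝ) • x = -(x - s) := by
      rw [sub_sub, ← add_smul]; norm_num
    simp only [e, sub_add_cancel, ContinuousLinearMap.mul_apply', fourierChar_eq_exp]
    rw [mul_comm, ← mul_assoc, ← mul_assoc, ← mul_assoc, ← Complex.exp_add,
      ← mul_add, ← Complex.ofReal_add, ← inner_add_right, neg_smul, neg_add_eq_sub]
  rw [this, enorm_mul, ← ofReal_norm, Circle.norm_coe, ENNReal.ofReal_one, one_mul]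

theorem lintegral_radarAmbiguity_weight_right {u v : 𝔼 → ℂ} (hu : Integrable u)
    (hv : Integrable v) (hum : Measurable u) (hvm : Measurable v) {ω : 𝔼 → ℝ≥0∞}
    (hω : Measurable ω) :
    ∫⁻ p : 𝔼 × 𝔼, ‖radarAmbiguity u v p.1 p.2‖ₑ ^ 2 * ω p.2 =
      ∫⁻ r, ∫⁻ s, ‖𝓕 u s‖ₑ ^ 2 * ‖𝓕 v r‖ₑ ^ 2 * ω (s - r) := by
  rw [← lintegral_lintegral_shear volume hω
    ((continuous_fourier_of_integrable hu).measurable.enorm.pow_const 2)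
    ((continuous_fourier_of_integrable hv).measurable.enorm.pow_const 2)]
  have hA := measurable_radarAmbiguity hum hvm
  rw [Measure.volume_eq_prod, lintegral_prod_symm _ (by fun_prop)]
  refine lintegral_congr fun y => ?_
  have hAy : Measurable fun x => ‖radarAmbiguity u v x y‖ₑ ^ 2 :=
    (hA.comp measurable_prodMk_right).enorm.pow_const 2
  dsimp only
  rw [lintegral_mul_const _ hAy, mul_comm]
  congr 1
  have ha : Integrable fun s => (Real.fourierChar (-⟪y, s⟫_ℝ) : ℂ) * u s := by
    refine hu.bdd_mul (c := 1) (Continuous.aestronglyMeasurable ?_) 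
      (.of_forall fun s => (Circle.norm_coe _).le)
    simp only [fourierChar_eq_exp]
    fun_prop
  have hb : Integrable fun s => conj (v (-s)) := 
    Complex.conjCLE.toContinuousLinearMap.integrable_comp hv.comp_neg
  simp_rw [enorm_radarAmbiguity_eq_convolution]
  rw [← lintegral_fourier_sq (ha.integrable_convolution _ hb)]
  refine lintegral_congr fun r => ?_
  rw [Real.fourier_mul_convolution_eq ha hb, fourier_mul_fourierChar, fourier_conj_comp_neg,
    enorm_mul, mul_pow, RCLike.enorm_conj]

end Radar

/-! ### Elementary estimates for the weight -/

/-- The weight `e^{π r²} / (1 + r)^K`. -/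
noncomputable def gaussWeight (K : ℕ) (r : ℝ) : ℝ := Real.exp (Real.pi * r ^ 2) / (1 + r) ^ K

theorem gaussWeight_nonneg (K : ℕ) {r : ℝ} (hr : 0 ≤ r) : 0 ≤ gaussWeight K r := by
  unfold gaussWeight; positivity

theorem measurable_gaussWeight (K : ℕ) : Measurable (gaussWeight K) := by
  unfold gaussWeight; fun_prop

theorem one_add_pow_le_exp (K : ℕ) {r : ℝ} (hr : 0 ≤ r) :
    (1 + r) ^ K ≤ K.factorial * Real.exp (1 + r) := by
  have := Real.pow_div_factorial_le_exp (1 + r) (by positivity) K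
  rw [div_le_iff₀ (by positivity)] at this
  linarith

/-- Since `π > 1`, the weight has room to absorb both a translation by `R` and the polynomial
denominator. -/
theorem exp_sq_le_gaussWeight (K : ℕ) {R r ρ : ℝ} (hR : 0 ≤ R) (hr : 0 ≤ r) (hρ : 0 ≤ ρ)
    (h : ρ ≤ r + R) :
    Real.exp (ρ ^ 2) ≤
      K.factorial * Real.exp ((2 * R + 1) ^ 2 + R ^ 2 + 1) * gaussWeight K r := by
  rw [gaussWeight, mul_div_assoc', le_div_iff₀ (by positivity)]
  calc Real.exp (ρ ^ 2) * (1 + r) ^ K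
      ≤ Real.exp (ρ ^ 2) * (K.factorial * Real.exp (1 + r)) := by
        gcongr; exact one_add_pow_le_exp K hr
    _ = K.factorial * Real.exp (ρ ^ 2 + (1 + r)) := by
        rw [Real.exp_add (ρ ^ 2)]; ring
    _ ≤ K.factorial * Real.exp (((2 * R + 1) ^ 2 + R ^ 2 + 1) + Real.pi * r ^ 2) := by
        refine mul_le_mul_of_nonneg_left (Real.exp_le_exp.2 ?_) (by positivity)
        have h1 : ρ ^ 2 ≤ (r + R) ^ 2 := by gcongr
        have h2 : 3 * r ^ 2 ≤ Real.pi * r ^ 2 := by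
          gcongr; exact Real.pi_gt_three.le
        nlinarith [sq_nonneg (2 * r - (2 * R + 1) / 2), sq_nonneg (2 * R + 1)]
    _ = _ := by rw [Real.exp_add _ (Real.pi * r ^ 2)]; ring

/-- Monotonicity up to a constant, used to replace `‖s - t‖` by the smaller `|⟨s - t, e⟩|`. -/
theorem gaussWeight_le_mul_of_le (K : ℕ) {x r : ℝ} (hx : 0 ≤ x) (h : x ≤ r) :
    gaussWeight K x ≤ K.factorial * Real.exp 2 * gaussWeight K r := by
  have hr := hx.trans h
  rw [gaussWeight, gaussWeight, mul_div_assoc', div_le_div_iff₀ (by positivity) (by positivity)]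
  calc Real.exp (Real.pi * x ^ 2) * (1 + r) ^ K
      ≤ Real.exp (Real.pi * x ^ 2) * ((1 + (r - x)) ^ K * (1 + x) ^ K) := by
        rw [← mul_pow]
        gcongr
        nlinarith
    _ ≤ Real.exp (Real.pi * x ^ 2) * ((K.factorial * Real.exp (1 + (r - x))) * (1 + x) ^ K) := by
        gcongr; exact one_add_pow_le_exp K (by linarith)
    _ = K.factorial * Real.exp (Real.pi * x ^ 2 + (1 + (r - x))) * (1 + x) ^ K := by
        rw [Real.exp_add (Real.pi * x ^ 2)]; ring
    _ ≤ K.factorial * Real.exp (2 + Real.pi * r ^ 2) * (1 + x) ^ K := by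
        refine mul_le_mul_of_nonneg_right (mul_le_mul_of_nonneg_left (Real.exp_le_exp.2 ?_)
          (by positivity)) (by positivity)
        have h2 : 3 * (r ^ 2 - x ^ 2) ≤ Real.pi * (r ^ 2 - x ^ 2) := by
          gcongr
          · nlinarith
          · exact Real.pi_gt_three.le
        nlinarith [sq_nonneg (r - x - 1)]
    _ = _ := by rw [Real.exp_add]; ring

/-- The inequality `2kE ≤ L k²Ω + E²/(ΩL)` with `Ω = exp(πρ²)` and `L = exp(2πa²)` would give the
right exponent, because `4πaρ - πρ² ≤ 4πa²`. But `ρ` is a distance `‖s - t‖`, so the last term would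
not be integrable in `(s, t)`. A small share `θ` of the exponent of `Ω` is therefore taken from `N =
‖s‖² + ‖t‖²`. -/
theorem mul_exp_le_of_gaussWeight (K : ℕ) {k ρ N a m D : ℝ} (hk0 : 0 ≤ k) (hρ0 : 0 ≤ ρ)
    (hN0 : 0 ≤ N) (hρN : ρ ^ 2 ≤ 2 * N) (hm : m = 1 + a ^ 2)
    (hD : D = K.factorial * 16 ^ K * Real.exp (4 * Real.pi + 1)) :
    k * Real.exp (2 * Real.pi * a * ρ) ≤ Real.exp (2 * Real.pi * a ^ 2) *
      (k ^ 2 * gaussWeight K ρ + k ^ 2 * Real.exp N +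
        D * m ^ K * Real.exp (-(N / (4 * m)))) := by
  have hm1 : 1 ≤ m := by nlinarith [sq_nonneg a]
  have hm0 : 0 < m := by linarith
  -- Small enough that `θ a² ≤ 1/2`, so the loss in the exponent is a constant. Then `θN = 2 ·
  -- N/(4m)`: one half absorbs `(1 + ρ)^K`, the other gives the integrable Gaussian.
  set θ : ℝ := 1 / (2 * m) with hθ
  have hθ0 : 0 < θ := by positivity
  have hθ1 : θ ≤ 1 / 2 := by
    rw [hθ]; gcongr; linarith
  set X : ℝ := (1 - θ) * (Real.pi * ρ ^ 2) + θ * N with hX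
  have hΩ : k ^ 2 * (Real.exp X / (1 + ρ) ^ K) ≤ k ^ 2 * gaussWeight K ρ + k ^ 2 * Real.exp N := by
    rw [← mul_add]
    gcongr
    have hone : 1 ≤ (1 + ρ) ^ K := one_le_pow₀ (by linarith)
    rcases le_total (Real.pi * ρ ^ 2) N with hc | hc
    · have : Real.exp X / (1 + ρ) ^ K ≤ Real.exp N := by
        refine (div_le_self (Real.exp_nonneg _) hone).trans ?_
        gcongr
        nlinarith
      linarith [gaussWeight_nonneg K hρ0]
    · have : Real.exp X / (1 + ρ) ^ K ≤ gaussWeight K ρ := by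
        unfold gaussWeight
        gcongr
        nlinarith
      linarith [Real.exp_nonneg N]
  have hpoly : (1 + ρ) ^ K ≤ K.factorial * 16 ^ K * m ^ K * Real.exp (1 + N / (4 * m)) := by
    have h1 : 1 + ρ ≤ 16 * m * (1 + N / (4 * m)) := by
      have : 16 * m * (1 + N / (4 * m)) = 16 * m + 4 * N := by field_simp; ring
      rw [this]
      nlinarith [sq_nonneg (ρ - 1)]
    calc (1 + ρ) ^ K ≤ (16 * m * (1 + N / (4 * m))) ^ K := by gcongr
      _ = 16 ^ K * m ^ K * (1 + N / (4 * m)) ^ K := by rw [mul_pow, mul_pow]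
      _ ≤ 16 ^ K * m ^ K * (K.factorial * Real.exp (1 + N / (4 * m))) := by
        gcongr; exact one_add_pow_le_exp K (by positivity)
      _ = _ := by ring
  have hquad : 4 * Real.pi * a * ρ - (1 - θ) * (Real.pi * ρ ^ 2) ≤
      4 * Real.pi * a ^ 2 + 4 * Real.pi := by
    have hmθ : θ * a ^ 2 ≤ 1 / 2 := by
      have : θ * a ^ 2 = 1 / 2 * (a ^ 2 / m) := by rw [hθ]; field_simp
      rw [this]
      have : a ^ 2 / m ≤ 1 := by rw [div_le_one hm0]; linarith
      linarith
    have h1 : 4 * a * ρ - (1 - θ) * ρ ^ 2 ≤ 4 * a ^ 2 + 4 := by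
      have h2 : (1 - θ) * (4 * a * ρ - (1 - θ) * ρ ^ 2) ≤ (1 - θ) * (4 * a ^ 2 + 4) := by
        nlinarith [sq_nonneg ((1 - θ) * ρ - 2 * a)]
      exact le_of_mul_le_mul_left h2 (by linarith)
    nlinarith [Real.pi_pos]
  have hE : Real.exp (4 * Real.pi * a * ρ) * (1 + ρ) ^ K / Real.exp X ≤
      Real.exp (4 * Real.pi * a ^ 2) * (D * m ^ K * Real.exp (-(N / (4 * m)))) := by
    rw [div_le_iff₀ (Real.exp_pos _)]
    calc Real.exp (4 * Real.pi * a * ρ) * (1 + ρ) ^ K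
        ≤ Real.exp (4 * Real.pi * a ^ 2 + 4 * Real.pi + (1 - θ) * (Real.pi * ρ ^ 2)) *
          (K.factorial * 16 ^ K * m ^ K * Real.exp (1 + N / (4 * m))) := by
            gcongr
            linarith
      _ = Real.exp (4 * Real.pi * a ^ 2) * (D * m ^ K * Real.exp (-(N / (4 * m)))) *
          Real.exp X := by
            have hθN : θ * N = N / (4 * m) + N / (4 * m) := by rw [hθ]; field_simp; ring
            have : Real.exp (4 * Real.pi * a ^ 2 + 4 * Real.pi + (1 - θ) * (Real.pi * ρ ^ 2)) *
                Real.exp (1 + N / (4 * m)) = Real.exp (4 * Real.pi * a ^ 2) *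
                Real.exp (4 * Real.pi + 1) * Real.exp (-(N / (4 * m))) * Real.exp X := by
              simp only [← Real.exp_add]
              congr 1
              rw [hX, hθN]; ring
            rw [hD]
            linear_combination (K.factorial * 16 ^ K * m ^ K) * this
  set E := Real.exp (2 * Real.pi * a * ρ) with hEdef
  set L := Real.exp (2 * Real.pi * a ^ 2) with hL
  have hE2 : Real.exp (4 * Real.pi * a * ρ) = E ^ 2 := by
    rw [hEdef, ← Real.exp_nat_mul]; congr 1; push_cast; ring
  have hL2 : Real.exp (4 * Real.pi * a ^ 2) = L ^ 2 := by
    rw [hL, ← Real.exp_nat_mul]; congr 1; push_cast; ring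
  rw [hE2, hL2] at hE
  have hLpos : 0 < L := Real.exp_pos _
  set Ω := Real.exp X / (1 + ρ) ^ K with hΩdef
  have hΩpos : 0 < Ω := by positivity
  have hE' : E ^ 2 / Ω ≤ L ^ 2 * (D * m ^ K * Real.exp (-(N / (4 * m)))) := by
    rw [hΩdef, div_div_eq_mul_div]; exact hE
  have hamgm : 2 * (k * E) ≤ L * (k ^ 2 * Ω) + E ^ 2 / Ω / L := by
    have : L * (k ^ 2 * Ω) + E ^ 2 / Ω / L - 2 * (k * E) =
        (L * k * Ω - E) ^ 2 / (Ω * L) := by field_simp; ring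
    have h0 : 0 ≤ (L * k * Ω - E) ^ 2 / (Ω * L) := by positivity
    linarith
  have hdiv : E ^ 2 / Ω / L ≤ L * (D * m ^ K * Real.exp (-(N / (4 * m)))) := by
    rw [div_le_iff₀ hLpos]; linarith
  have hlast : L * (k ^ 2 * Ω) ≤ L * (k ^ 2 * gaussWeight K ρ + k ^ 2 * Real.exp N) := by gcongr
  have : 0 ≤ k * E := by positivity
  linarith

/-! ### Gaussian decay and exponential moments -/

section Decay

variable {V : Type*} [NormedAddCommGroup V] [InnerProductSpace ℝ V] [FiniteDimensional ℝ V]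
  [MeasurableSpace V] [BorelSpace V]

/-- Some `r` has `G r ≠ 0` and a finite inner integral; freezing it leaves a Gaussian weight for `F`
centred at `r`. -/
theorem lintegral_mul_exp_sq_lt_top {F G : V → ℝ≥0∞} (hF : Measurable F) (hG : Measurable G)
    {K : ℕ}
    (h : ∫⁻ r, ∫⁻ s, F s * G r * ENNReal.ofReal (gaussWeight K ‖s - r‖) < ∞)
    (hG0 : ¬ G =ᵐ[volume] 0) : ∫⁻ s, F s * ENNReal.ofReal (Real.exp (‖s‖ ^ 2)) < ∞ := by
  have hW : Measurable fun p : V × V => ENNReal.ofReal (gaussWeight K ‖p.2 - p.1‖) :=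
    ((measurable_gaussWeight K).comp (by fun_prop)).ennreal_ofReal
  have hmeas : Measurable fun r => ∫⁻ s, F s * G r * ENNReal.ofReal (gaussWeight K ‖s - r‖) :=
    Measurable.lintegral_prod_right'
      (f := fun p : V × V => F p.2 * G p.1 * ENNReal.ofReal (gaussWeight K ‖p.2 - p.1‖))
      (by fun_prop)
  have h1 := ae_lt_top hmeas h.ne
  have h2 : ∃ᶠ r in ae (volume : Measure V), G r ≠ 0 := fun hc =>
    hG0 (hc.mono fun r hr => by simpa using hr)
  obtain ⟨r, hr0, hr⟩ := (h2.and_eventually h1).exists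
  have h3 : ∫⁻ s, F s * ENNReal.ofReal (gaussWeight K ‖s - r‖) < ∞ := by
    have hWr : Measurable fun s : V => ENNReal.ofReal (gaussWeight K ‖s - r‖) :=
      ((measurable_gaussWeight K).comp
        (by fun_prop : Measurable fun s : V => ‖s - r‖)).ennreal_ofReal
    have e : ∀ s, F s * G r * ENNReal.ofReal (gaussWeight K ‖s - r‖) =
        G r * (F s * ENNReal.ofReal (gaussWeight K ‖s - r‖)) := fun s => by ring
    have hr : ∫⁻ s, G r * (F s * ENNReal.ofReal (gaussWeight K ‖s - r‖)) < ∞ :=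
      lt_of_eq_of_lt (lintegral_congr fun s => (e s).symm) hr
    rw [lintegral_const_mul _ (f := fun s => F s * ENNReal.ofReal (gaussWeight K ‖s - r‖))
      (hF.mul hWr)] at hr
    by_contra hc
    rw [not_lt_top_iff] at hc
    rw [hc, ENNReal.mul_top hr0] at hr
    exact lt_irrefl _ hr
  set A : ℝ := K.factorial * Real.exp ((2 * ‖r‖ + 1) ^ 2 + ‖r‖ ^ 2 + 1) with hA
  have hA0 : 0 ≤ A := by positivity
  calc ∫⁻ s, F s * ENNReal.ofReal (Real.exp (‖s‖ ^ 2))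
      ≤ ∫⁻ s, ENNReal.ofReal A * (F s * ENNReal.ofReal (gaussWeight K ‖s - r‖)) := by
        refine lintegral_mono fun s => ?_
        have := exp_sq_le_gaussWeight K (norm_nonneg r) (norm_nonneg (s - r)) (norm_nonneg s)
          (by simpa using norm_add_le (s - r) r)
        calc F s * ENNReal.ofReal (Real.exp (‖s‖ ^ 2))
            ≤ F s * ENNReal.ofReal (A * gaussWeight K ‖s - r‖) := by gcongr
          _ = _ := by rw [ENNReal.ofReal_mul hA0]; ring
    _ = ENNReal.ofReal A * ∫⁻ s, F s * ENNReal.ofReal (gaussWeight K ‖s - r‖) :=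
        lintegral_const_mul' _ _ ENNReal.ofReal_ne_top
    _ < ∞ := ENNReal.mul_lt_top ENNReal.ofReal_lt_top h3

theorem lintegral_gaussWeight_symm {F G : V → ℝ≥0∞} (hF : Measurable F) (hG : Measurable G)
    {K : ℕ} :
    ∫⁻ r, ∫⁻ s, F s * G r * ENNReal.ofReal (gaussWeight K ‖s - r‖) =
      ∫⁻ r, ∫⁻ s, G s * F r * ENNReal.ofReal (gaussWeight K ‖s - r‖) := by
  have hW : Measurable fun p : V × V => ENNReal.ofReal (gaussWeight K ‖p.2 - p.1‖) :=
    ((measurable_gaussWeight K).comp (by fun_prop)).ennreal_ofReal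
  rw [lintegral_lintegral_swap (by fun_prop)]
  refine lintegral_congr fun r => lintegral_congr fun s => ?_
  rw [norm_sub_rev, mul_comm (F r)]

theorem integrable_exp_neg_mul_sq_norm {b : ℝ} (hb : 0 < b) :
    Integrable fun v : V => Real.exp (-b * ‖v‖ ^ 2) := by
  by_contra h
  have h1 := GaussianFourier.integral_rexp_neg_mul_sq_norm (V := V) hb
  rw [integral_undef h] at h1
  have : 0 < (Real.pi / b) ^ (Module.finrank ℝ V / 2 : ℝ) := by positivity
  linarith

theorem integrable_norm_mul_exp_of_sq {p : V → ℂ} (hp : AEStronglyMeasurable p)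
    (h : Integrable fun s => ‖p s‖ ^ 2 * Real.exp (‖s‖ ^ 2)) (c : ℝ) :
    Integrable fun s => ‖p s‖ * Real.exp (c * ‖s‖) := by
  have h1 := (integrable_exp_neg_mul_sq_norm (V := V) (b := 1 / 2) (by norm_num)).const_mul
    (Real.exp (2 * c ^ 2))
  refine (h.add h1).mono' (hp.norm.mul (by fun_prop)) (.of_forall fun s => ?_)
  rw [Real.norm_of_nonneg (by positivity)]
  simp only [Pi.add_apply]
  have e1 : ‖p s‖ ^ 2 * Real.exp (‖s‖ ^ 2) = (‖p s‖ * Real.exp (‖s‖ ^ 2 / 2)) ^ 2 := by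
    rw [mul_pow, ← Real.exp_nat_mul]; congr 2; push_cast; ring
  have e2 : (Real.exp (c * ‖s‖ - ‖s‖ ^ 2 / 2)) ^ 2 ≤
      Real.exp (2 * c ^ 2) * Real.exp (-(1 / 2) * ‖s‖ ^ 2) := by
    rw [← Real.exp_nat_mul, ← Real.exp_add]
    gcongr
    push_cast
    nlinarith [sq_nonneg (2 * c - ‖s‖)]
  have e3 : ‖p s‖ * Real.exp (c * ‖s‖) =
      (‖p s‖ * Real.exp (‖s‖ ^ 2 / 2)) * Real.exp (c * ‖s‖ - ‖s‖ ^ 2 / 2) := by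
    rw [mul_assoc, ← Real.exp_add]; ring_nf
  rw [e3, e1]
  nlinarith [sq_nonneg (‖p s‖ * Real.exp (‖s‖ ^ 2 / 2) - Real.exp (c * ‖s‖ - ‖s‖ ^ 2 / 2)),
    sq_nonneg (‖p s‖ * Real.exp (‖s‖ ^ 2 / 2)), sq_nonneg (Real.exp (c * ‖s‖ - ‖s‖ ^ 2 / 2))]

theorem integrable_sq_mul_exp_of_lintegral {p : V → ℂ} (hp : Measurable p)
    (h : ∫⁻ s, ‖p s‖ₑ ^ 2 * ENNReal.ofReal (Real.exp (‖s‖ ^ 2)) < ∞) :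
    Integrable fun s => ‖p s‖ ^ 2 * Real.exp (‖s‖ ^ 2) := by
  refine ⟨by fun_prop, ?_⟩
  rw [hasFiniteIntegral_iff_ofReal (.of_forall fun s => by positivity)]
  refine lt_of_eq_of_lt (lintegral_congr fun s => ?_) h
  rw [ENNReal.ofReal_mul (by positivity), ENNReal.ofReal_pow (norm_nonneg _), ofReal_norm]

theorem integrable_prod_weight {p q : V → ℂ} (hp : Measurable p) (hq : Measurable q) {K : ℕ}
    (h : ∫⁻ r, ∫⁻ s, ‖p s‖ₑ ^ 2 * ‖q r‖ₑ ^ 2 * ENNReal.ofReal (gaussWeight K ‖s - r‖) < ∞) :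
    Integrable fun z : V × V => (‖p z.1‖ * ‖q z.2‖) ^ 2 * gaussWeight K ‖z.1 - z.2‖ := by
  have hW : Measurable fun p : V × V => gaussWeight K ‖p.1 - p.2‖ :=
    (measurable_gaussWeight K).comp (by fun_prop)
  refine ⟨by fun_prop, ?_⟩
  rw [hasFiniteIntegral_iff_ofReal
    (.of_forall fun z => mul_nonneg (by positivity) (gaussWeight_nonneg K (norm_nonneg _)))]
  refine lt_of_eq_of_lt ?_ h
  rw [Measure.volume_eq_prod, lintegral_prod_symm _ (by fun_prop)]
  refine lintegral_congr fun r => lintegral_congr fun s => ?_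
  rw [ENNReal.ofReal_mul (by positivity), ENNReal.ofReal_pow (by positivity),
    ENNReal.ofReal_mul (by positivity), ofReal_norm, ofReal_norm, mul_pow]

/-- Integrates `mul_exp_le_of_gaussWeight`. The exponent `2πa²` is sharp for the later argument; the
loss is only polynomial in `a`. -/
theorem exists_integral_prod_mul_exp_le {p q : V → ℂ} (hp : Measurable p) (hq : Measurable q)
    {K : ℕ}
    (h : Integrable fun z : V × V => (‖p z.1‖ * ‖q z.2‖) ^ 2 * gaussWeight K ‖z.1 - z.2‖)
    (hp2 : Integrable fun s => ‖p s‖ ^ 2 * Real.exp (‖s‖ ^ 2))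
    (hq2 : Integrable fun s => ‖q s‖ ^ 2 * Real.exp (‖s‖ ^ 2)) :
    ∃ C : ℝ, 0 ≤ C ∧ ∃ M : ℕ, ∀ a : ℝ,
      Integrable (fun z : V × V => ‖p z.1‖ * ‖q z.2‖ *
        Real.exp (2 * Real.pi * a * ‖z.1 - z.2‖)) ∧
      ∫ z : V × V, ‖p z.1‖ * ‖q z.2‖ * Real.exp (2 * Real.pi * a * ‖z.1 - z.2‖) ≤
        C * (1 + a ^ 2) ^ M * Real.exp (2 * Real.pi * a ^ 2) := by
  have hpq2 := hp2.mul_prod hq2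
  set A : ℝ := ∫ z : V × V, (‖p z.1‖ * ‖q z.2‖) ^ 2 * gaussWeight K ‖z.1 - z.2‖
  set B : ℝ := ∫ z : V × V, ‖p z.1‖ ^ 2 * Real.exp (‖z.1‖ ^ 2) *
    (‖q z.2‖ ^ 2 * Real.exp (‖z.2‖ ^ 2))
  have hA : 0 ≤ A := integral_nonneg fun z =>
    mul_nonneg (by positivity) (gaussWeight_nonneg K (norm_nonneg _))
  have hB : 0 ≤ B := integral_nonneg fun z => by positivity
  set D : ℝ := K.factorial * 16 ^ K * Real.exp (4 * Real.pi + 1) with hD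
  have hD0 : 0 ≤ D := by positivity
  set n := Module.finrank ℝ V
  -- The power `K` of `1 + a²` comes from the pointwise estimate, and `n` from a Gaussian of
  -- variance proportional to `1 + a²` integrated over `V × V`.
  refine ⟨A + B + D * (4 * Real.pi) ^ n, by positivity, K + n, fun a => ?_⟩
  set m : ℝ := 1 + a ^ 2 with hm
  have hm1 : 1 ≤ m := by nlinarith [sq_nonneg a]
  have hm0 : 0 < m := by linarith
  have hb : 0 < 1 / (4 * m) := by positivity
  have hG := (integrable_exp_neg_mul_sq_norm (V := V) hb).mul_prod
    (integrable_exp_neg_mul_sq_norm (V := V) hb)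
  have key : ∀ z : V × V, ‖p z.1‖ * ‖q z.2‖ * Real.exp (2 * Real.pi * a * ‖z.1 - z.2‖) ≤
      Real.exp (2 * Real.pi * a ^ 2) * ((‖p z.1‖ * ‖q z.2‖) ^ 2 * gaussWeight K ‖z.1 - z.2‖ +
        ‖p z.1‖ ^ 2 * Real.exp (‖z.1‖ ^ 2) * (‖q z.2‖ ^ 2 * Real.exp (‖z.2‖ ^ 2)) +
        D * m ^ K * (Real.exp (-(1 / (4 * m)) * ‖z.1‖ ^ 2) *
          Real.exp (-(1 / (4 * m)) * ‖z.2‖ ^ 2))) := by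
    rintro ⟨s, t⟩
    dsimp only
    set k := ‖p s‖ * ‖q t‖ with hk
    set ρ := ‖s - t‖ with hρ
    set N := ‖s‖ ^ 2 + ‖t‖ ^ 2 with hN
    have hρN : ρ ^ 2 ≤ 2 * N := by
      have : ρ ≤ ‖s‖ + ‖t‖ := norm_sub_le s t
      have : ρ ^ 2 ≤ (‖s‖ + ‖t‖) ^ 2 := by gcongr
      nlinarith [sq_nonneg (‖s‖ - ‖t‖)]
    have e1 : ‖p s‖ ^ 2 * Real.exp (‖s‖ ^ 2) * (‖q t‖ ^ 2 * Real.exp (‖t‖ ^ 2)) =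
        k ^ 2 * Real.exp N := by
      rw [hN, Real.exp_add]; ring
    have e2 : Real.exp (-(1 / (4 * m)) * ‖s‖ ^ 2) * Real.exp (-(1 / (4 * m)) * ‖t‖ ^ 2) =
        Real.exp (-(N / (4 * m))) := by
      rw [← Real.exp_add]; congr 1; rw [hN]; ring
    rw [e1, e2]
    exact mul_exp_le_of_gaussWeight K (by positivity) (norm_nonneg _) (by positivity) hρN hm hD
  have hint : Integrable fun z : V × V => Real.exp (2 * Real.pi * a ^ 2) *
      ((‖p z.1‖ * ‖q z.2‖) ^ 2 * gaussWeight K ‖z.1 - z.2‖ +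
        ‖p z.1‖ ^ 2 * Real.exp (‖z.1‖ ^ 2) * (‖q z.2‖ ^ 2 * Real.exp (‖z.2‖ ^ 2)) +
        D * m ^ K * (Real.exp (-(1 / (4 * m)) * ‖z.1‖ ^ 2) *
          Real.exp (-(1 / (4 * m)) * ‖z.2‖ ^ 2))) := (((h.add hpq2).add (hG.const_mul (D * m ^ K))).const_mul
    (Real.exp (2 * Real.pi * a ^ 2)))
  have hmain : Integrable (fun z : V × V => ‖p z.1‖ * ‖q z.2‖ *
      Real.exp (2 * Real.pi * a * ‖z.1 - z.2‖)) := by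
    refine hint.mono' (by fun_prop) (.of_forall fun z => ?_)
    rw [Real.norm_of_nonneg (by positivity)]
    exact key z
  refine ⟨hmain, (integral_mono hmain hint key).trans ?_⟩
  have hGint : ∫ z : V × V, Real.exp (-(1 / (4 * m)) * ‖z.1‖ ^ 2) *
      Real.exp (-(1 / (4 * m)) * ‖z.2‖ ^ 2) = (4 * Real.pi * m) ^ n := by
    rw [Measure.volume_eq_prod, integral_prod_mul (fun s : V => Real.exp (-(1 / (4 * m)) * ‖s‖ ^ 2))
      (fun s : V => Real.exp (-(1 / (4 * m)) * ‖s‖ ^ 2)),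
      GaussianFourier.integral_rexp_neg_mul_sq_norm hb, ← Real.rpow_add (by positivity),
      add_halves, Real.rpow_natCast]
    congr 1
    field_simp
  have hsum : ∫ z : V × V, Real.exp (2 * Real.pi * a ^ 2) *
      ((‖p z.1‖ * ‖q z.2‖) ^ 2 * gaussWeight K ‖z.1 - z.2‖ +
        ‖p z.1‖ ^ 2 * Real.exp (‖z.1‖ ^ 2) * (‖q z.2‖ ^ 2 * Real.exp (‖z.2‖ ^ 2)) +
        D * m ^ K * (Real.exp (-(1 / (4 * m)) * ‖z.1‖ ^ 2) *
          Real.exp (-(1 / (4 * m)) * ‖z.2‖ ^ 2))) =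
      Real.exp (2 * Real.pi * a ^ 2) * (A + B + D * m ^ K * (4 * Real.pi * m) ^ n) := by
    rw [integral_const_mul]
    congr 1
    refine (integral_add (h.add hpq2) (hG.const_mul _)).trans ?_
    rw [integral_const_mul, hGint]
    congr 1
    exact integral_add h hpq2
  rw [hsum]
  have h1 : 1 ≤ m ^ (K + n) := one_le_pow₀ hm1
  have h2 : D * m ^ K * (4 * Real.pi * m) ^ n = D * (4 * Real.pi) ^ n * m ^ (K + n) := by
    rw [mul_pow, pow_add]; ring
  rw [h2, mul_comm]
  gcongr
  nlinarith
end Decay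

/-! ### Phragmén–Lindelöf at the critical order and a one-variable Hardy theorem -/

section CriticalPhragmenLindelof

open Complex Set Filter Topology

theorem norm_exp_I_mul_sq (δ : ℝ) (w : ℂ) :
    ‖Complex.exp (Complex.I * δ * w ^ 2)‖ = Real.exp (-(2 * δ * w.re * w.im)) := by
  rw [Complex.norm_exp]
  congr 1
  simp [pow_two]
  ring

theorem cpow_ofReal_re_im_nonneg {ζ : ℂ} (h1 : 0 ≤ ζ.re) (h2 : 0 ≤ ζ.im) {β : ℝ} (hβ0 : 0 < β)
    (hβ1 : β ≤ 1) : 0 ≤ (ζ ^ (β : ℂ)).re ∧ 0 ≤ (ζ ^ (β : ℂ)).im := by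
  have ha0 : 0 ≤ arg ζ := arg_nonneg_iff.2 h2
  have ha1 : arg ζ ≤ Real.pi / 2 := arg_le_pi_div_two_iff.2 (Or.inl h1)
  have hb0 : 0 ≤ arg ζ * β := by positivity
  have hb1 : arg ζ * β ≤ Real.pi / 2 := by nlinarith
  rw [cpow_ofReal_re, cpow_ofReal_im]
  exact ⟨mul_nonneg (by positivity) (Real.cos_nonneg_of_mem_Icc ⟨by linarith [Real.pi_pos], hb1⟩),
    mul_nonneg (by positivity) (Real.sin_nonneg_of_mem_Icc ⟨hb0, by linarith [Real.pi_pos]⟩)⟩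

/-- Order 2 is critical for a quadrant, but subcritical for the sector `0 ≤ arg ≤ φ` with `φ < π/2`.
On the ray `arg = φ` one has `b (Re z)² = b cot φ · Re z · Im z`, which the factor `exp(iδz²)` with
`2δ = b cot φ` cancels exactly. The map `ζ ↦ ζ^β`, `β = 2φ/π`, carries the quadrant onto the sector
and turns the growth into order `2β < 2`. -/
theorem norm_le_mul_exp_of_sector {f : ℂ → ℂ} {C b : ℝ} (hb : 0 ≤ b)
    (hf : ∀ z : ℂ, 0 ≤ z.re → 0 ≤ z.im → DifferentiableAt ℂ f z)
    (hbd : ∀ z : ℂ, 0 ≤ z.re → 0 ≤ z.im → ‖f z‖ ≤ C * Real.exp (b * z.re ^ 2))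
    (hre : ∀ x : ℝ, 0 ≤ x → ‖f x‖ ≤ C) {z : ℂ} (h1 : 0 < z.re) (h2 : 0 < z.im) {φ : ℝ}
    (hφ : arg z < φ) (hφ2 : φ < Real.pi / 2) :
    ‖f z‖ ≤ C * Real.exp (b * (Real.cos φ / Real.sin φ) * z.re * z.im) := by
  have hpi := Real.pi_pos
  have ha0 : 0 ≤ arg z := arg_nonneg_iff.2 h2.le
  have hφ0 : 0 < φ := ha0.trans_lt hφ
  have hsin : 0 < Real.sin φ := Real.sin_pos_of_pos_of_lt_pi hφ0 (by linarith)
  have hcos : 0 < Real.cos φ := Real.cos_pos_of_mem_Ioo ⟨by linarith, hφ2⟩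
  have hC : 0 ≤ C := (norm_nonneg _).trans (hre 0 le_rfl)
  set β : ℝ := 2 * φ / Real.pi with hβ
  have hβ0 : 0 < β := by positivity
  have hβ1 : β < 1 := by rw [hβ, div_lt_one hpi]; linarith
  set δ : ℝ := b * (Real.cos φ / Real.sin φ) / 2 with hδ
  have hδ0 : 0 ≤ δ := by positivity
  set F : ℂ → ℂ := fun ζ => f (ζ ^ (β : ℂ)) * Complex.exp (Complex.I * δ * (ζ ^ (β : ℂ)) ^ 2)
  have hcl : closure (Ioi (0 : ℝ) ×ℂ Ioi (0 : ℝ)) ⊆ {z : ℂ | 0 ≤ z.re ∧ 0 ≤ z.im} := by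
    rw [closure_reProdIm, closure_Ioi]
    intro z hz
    exact ⟨hz.1, hz.2⟩
  have hFd : DiffContOnCl ℂ F (Ioi 0 ×ℂ Ioi 0) := by
    constructor
    · intro ζ hζ
      have hζ1 : 0 < ζ.re := hζ.1
      have hζ2 : 0 < ζ.im := hζ.2
      have hp := cpow_ofReal_re_im_nonneg hζ1.le hζ2.le hβ0 hβ1.le
      have hc : DifferentiableAt ℂ (fun ζ : ℂ => ζ ^ (β : ℂ)) ζ :=
        differentiableAt_id.cpow_const (Or.inl hζ1)
      refine DifferentiableAt.differentiableWithinAt ?_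
      exact ((hf _ hp.1 hp.2).comp ζ hc).mul
        ((hc.pow 2).const_mul (Complex.I * δ)).cexp
    · intro ζ hζ
      obtain ⟨hζ1, hζ2⟩ := hcl hζ
      have hp := cpow_ofReal_re_im_nonneg hζ1 hζ2 hβ0 hβ1.le
      have hc : ContinuousAt (fun ζ : ℂ => ζ ^ (β : ℂ)) ζ :=
        continuousAt_cpow_const_of_re_pos (Or.inl hζ1) (by simpa using hβ0)
      refine ContinuousAt.continuousWithinAt ?_
      exact (ContinuousAt.comp (f := fun ζ : ℂ => ζ ^ (β : ℂ)) (g := f)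
        (hf _ hp.1 hp.2).continuousAt hc).mul
        ((hc.pow 2).const_mul (Complex.I * δ)).cexp
  have hFn : ∀ ζ : ℂ, ‖F ζ‖ = ‖f (ζ ^ (β : ℂ))‖ *
      Real.exp (-(2 * δ * (ζ ^ (β : ℂ)).re * (ζ ^ (β : ℂ)).im)) := fun ζ => by
    rw [norm_mul, norm_exp_I_mul_sq]
  have hB : ∃ c < (2 : ℝ), ∃ B, F =O[Bornology.cobounded ℂ ⊓ 𝓟 (Ioi 0 ×ℂ Ioi 0)]
      fun z => Real.exp (B * ‖z‖ ^ c) := by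
    refine ⟨2 * β, by linarith, b, Asymptotics.IsBigO.of_bound C ?_⟩
    refine eventually_inf_principal.2 (.of_forall fun ζ hζ => ?_)
    have hζ1 : 0 < ζ.re := hζ.1
    have hζ2 : 0 < ζ.im := hζ.2
    have hp := cpow_ofReal_re_im_nonneg hζ1.le hζ2.le hβ0 hβ1.le
    have hn : (ζ ^ (β : ℂ)).re ^ 2 ≤ ‖ζ‖ ^ (2 * β) := by
      rw [mul_comm, Real.rpow_mul (norm_nonneg _), ← norm_cpow_real, Real.rpow_two]
      exact pow_le_pow_left₀ hp.1 (re_le_norm _) 2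
    rw [hFn, Real.norm_of_nonneg (Real.exp_nonneg _)]
    calc _ ≤ C * Real.exp (b * (ζ ^ (β : ℂ)).re ^ 2) * 1 := by
          gcongr
          · exact hbd _ hp.1 hp.2
          · rw [Real.exp_le_one_iff, neg_nonpos]
            have := mul_nonneg hp.1 hp.2
            nlinarith
      _ ≤ _ := by rw [mul_one]; gcongr
  have hFre : ∀ x : ℝ, 0 ≤ x → ‖F x‖ ≤ C := fun x hx => by
    rw [hFn, ← ofReal_cpow hx]
    simpa using hre (x ^ β) (by positivity)
  have hFim : ∀ x : ℝ, 0 ≤ x → ‖F (x * Complex.I)‖ ≤ C := fun x hx => by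
    have hp := cpow_ofReal_re_im_nonneg (ζ := x * Complex.I) (by simp) (by simpa using hx) hβ0
      hβ1.le
    rw [hFn]
    refine (mul_le_mul_of_nonneg_right (hbd _ hp.1 hp.2) (Real.exp_nonneg _)).trans ?_
    rw [mul_assoc, ← Real.exp_add]
    refine (mul_le_of_le_one_right hC ?_)
    rw [Real.exp_le_one_iff]
    rcases hx.eq_or_lt with rfl | hx
    · simp [zero_cpow (ofReal_ne_zero.2 hβ0.ne')]
    · have harg : arg (x * Complex.I) * β = φ := by
        rw [arg_real_mul _ hx, arg_I, hβ]; field_simp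
      rw [cpow_ofReal_re, cpow_ofReal_im, harg, hδ]
      field_simp
      ring_nf
      exact le_rfl
  set ζ : ℂ := Complex.exp (Complex.log z / β) with hζ
  have hz0 : z ≠ 0 := by rintro rfl; simp at h1
  have hβc : (β : ℂ) ≠ 0 := ofReal_ne_zero.2 hβ0.ne'
  have him : (Complex.log z / β).im = arg z / β := by
    rw [div_ofReal_im, log_im]
  have hle : arg z / β < Real.pi / 2 := by
    rw [div_lt_iff₀ hβ0, hβ]; field_simp; linarith
  have hge : 0 ≤ arg z / β := by positivity
  have hpow : ζ ^ (β : ℂ) = z := by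
    rw [cpow_def_of_ne_zero (Complex.exp_ne_zero _), log_exp (by rw [him]; linarith)
      (by rw [him]; linarith), div_mul_cancel₀ _ hβc, exp_log hz0]
  have hζre : 0 ≤ ζ.re := by
    rw [hζ, exp_re, him]
    exact mul_nonneg (Real.exp_nonneg _)
      (Real.cos_nonneg_of_mem_Icc ⟨by linarith, hle.le⟩)
  have hζim : 0 ≤ ζ.im := by
    rw [hζ, exp_im, him]
    exact mul_nonneg (Real.exp_nonneg _) (Real.sin_nonneg_of_mem_Icc ⟨hge, by linarith⟩)
  have := PhragmenLindelof.quadrant_I hFd hB hFre hFim hζre hζim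
  rw [hFn, hpow, Real.exp_neg, ← div_eq_mul_inv, div_le_iff₀ (Real.exp_pos _)] at this
  rwa [show b * (Real.cos φ / Real.sin φ) * z.re * z.im = 2 * δ * z.re * z.im by rw [hδ]; ring]

/-- Let `φ → π/2` in the sector estimate: the cotangent tends to `0`. -/
theorem norm_le_of_quadrant {f : ℂ → ℂ} {C b : ℝ} (hb : 0 ≤ b)
    (hf : ∀ z : ℂ, 0 ≤ z.re → 0 ≤ z.im → DifferentiableAt ℂ f z)
    (hbd : ∀ z : ℂ, 0 ≤ z.re → 0 ≤ z.im → ‖f z‖ ≤ C * Real.exp (b * z.re ^ 2))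
    (hre : ∀ x : ℝ, 0 ≤ x → ‖f x‖ ≤ C) {z : ℂ} (h1 : 0 ≤ z.re) (h2 : 0 ≤ z.im) :
    ‖f z‖ ≤ C := by
  rcases h1.eq_or_lt with h1' | h1'
  · simpa [← h1'] using hbd z h1 h2
  rcases h2.eq_or_lt with h2' | h2'
  · have : z = (z.re : ℂ) := Complex.ext rfl (by simpa using h2'.symm)
    rw [this]
    exact hre _ h1
  have harg : arg z < Real.pi / 2 := by
    have := abs_arg_lt_pi_div_two_iff.2 (Or.inl h1')
    exact lt_of_abs_lt this
  have hlim : Tendsto (fun φ : ℝ => C * Real.exp (b * (Real.cos φ / Real.sin φ) * z.re * z.im))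
      (𝓝[<] (Real.pi / 2)) (𝓝 C) := by
    have hcont : ContinuousAt
        (fun φ : ℝ => C * Real.exp (b * (Real.cos φ / Real.sin φ) * z.re * z.im))
        (Real.pi / 2) := by
      have : ContinuousAt (fun φ : ℝ => Real.cos φ / Real.sin φ) (Real.pi / 2) :=
        Real.continuous_cos.continuousAt.div Real.continuous_sin.continuousAt (by simp)
      fun_prop
    have := hcont.tendsto.mono_left (nhdsWithin_le_nhds (s := Iio (Real.pi / 2)))
    simpa using this
  refine ge_of_tendsto hlim ?_
  filter_upwards [Ioo_mem_nhdsLT harg] with φ hφ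
  exact norm_le_mul_exp_of_sector hb hf hbd hre h1' h2' hφ.1 hφ.2

/-- Divide by `(z + 1 + i)^M`, which does not vanish on the closed quadrant and has size comparable
to `(1 + ‖z‖)^M` there. -/
theorem norm_le_pow_of_quadrant {f : ℂ → ℂ} {C b : ℝ} {M : ℕ} (hb : 0 ≤ b)
    (hf : Differentiable ℂ f)
    (hbd : ∀ z : ℂ, ‖f z‖ ≤ C * (1 + ‖z‖) ^ M * Real.exp (b * z.re ^ 2))
    (hre : ∀ x : ℝ, ‖f x‖ ≤ C * (1 + |x|) ^ M) {z : ℂ} (h1 : 0 ≤ z.re) (h2 : 0 ≤ z.im) :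
    ‖f z‖ ≤ C * 6 ^ M * (1 + ‖z‖) ^ M := by
  have hC : 0 ≤ C := by simpa using (norm_nonneg _).trans (hre 0)
  have hlow : ∀ w : ℂ, 0 ≤ w.re → 0 ≤ w.im → 1 + ‖w‖ ≤ 2 * ‖w + 1 + Complex.I‖ := by
    intro w hw1 hw2
    have h3 : ‖w‖ ≤ ‖w + 1 + Complex.I‖ := by
      rw [Complex.norm_def, Complex.norm_def, normSq_apply, normSq_apply]
      refine Real.sqrt_le_sqrt ?_
      simp
      nlinarith
    have h4 : 1 ≤ ‖w + 1 + Complex.I‖ := by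
      refine le_trans ?_ (re_le_norm _)
      simpa using hw1
    linarith
  have hne : ∀ w : ℂ, 0 ≤ w.re → 0 ≤ w.im → w + 1 + Complex.I ≠ 0 := by
    intro w hw1 hw2 h0
    have := hlow w hw1 hw2
    rw [h0] at this
    simp at this
    linarith [norm_nonneg w]
  have key : ∀ w : ℂ, 0 ≤ w.re → 0 ≤ w.im → ∀ X : ℝ, 0 ≤ X → ‖f w‖ ≤ C * (1 + ‖w‖) ^ M * X →
      ‖f w / (w + 1 + Complex.I) ^ M‖ ≤ C * 2 ^ M * X := by
    intro w hw1 hw2 X hX hwX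
    rw [norm_div, norm_pow, div_le_iff₀ (pow_pos (norm_pos_iff.2 (hne w hw1 hw2)) M)]
    calc ‖f w‖ ≤ C * (1 + ‖w‖) ^ M * X := hwX
      _ ≤ C * (2 * ‖w + 1 + Complex.I‖) ^ M * X := by
        gcongr
        exact hlow w hw1 hw2
      _ = _ := by rw [mul_pow]; ring
  have := norm_le_of_quadrant (f := fun w => f w / (w + 1 + Complex.I) ^ M) (C := C * 2 ^ M) hb
    (fun w hw1 hw2 => (hf w).div (by fun_prop) (pow_ne_zero _ (hne w hw1 hw2)))
    (fun w hw1 hw2 => key w hw1 hw2 _ (Real.exp_nonneg _) (hbd w))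
    (fun x hx => by
      have := key x (by simpa using hx) (by simp) 1 zero_le_one (by simpa using hre x)
      simpa using this) h1 h2
  rw [norm_div, norm_pow, div_le_iff₀ (pow_pos (norm_pos_iff.2 (hne z h1 h2)) M)] at this
  refine this.trans ?_
  have h5 : ‖z + 1 + Complex.I‖ ≤ 3 * (1 + ‖z‖) := by
    have := norm_add₃_le (a := z) (b := 1) (c := Complex.I)
    simp at this
    linarith [norm_nonneg z]
  calc C * 2 ^ M * ‖z + 1 + Complex.I‖ ^ M ≤ C * 2 ^ M * (3 * (1 + ‖z‖)) ^ M := by gcongr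
    _ = _ := by rw [mul_pow, show (6 : ℝ) = 2 * 3 by norm_num, mul_pow]; ring

theorem norm_le_pow_of_entire {f : ℂ → ℂ} {C b : ℝ} {M : ℕ} (hb : 0 ≤ b)
    (hf : Differentiable ℂ f)
    (hbd : ∀ z : ℂ, ‖f z‖ ≤ C * (1 + ‖z‖) ^ M * Real.exp (b * z.re ^ 2))
    (hre : ∀ x : ℝ, ‖f x‖ ≤ C * (1 + |x|) ^ M) (z : ℂ) :
    ‖f z‖ ≤ C * 6 ^ M * (1 + ‖z‖) ^ M := by
  have upper : ∀ g : ℂ → ℂ, Differentiable ℂ g →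
      (∀ z : ℂ, ‖g z‖ ≤ C * (1 + ‖z‖) ^ M * Real.exp (b * z.re ^ 2)) →
      (∀ x : ℝ, ‖g x‖ ≤ C * (1 + |x|) ^ M) → ∀ z : ℂ, 0 ≤ z.im →
      ‖g z‖ ≤ C * 6 ^ M * (1 + ‖z‖) ^ M := by
    intro g hg hgb hgr z hz
    rcases le_total 0 z.re with h | h
    · exact norm_le_pow_of_quadrant hb hg hgb hgr h hz
    -- Reflection in the imaginary axis moves the second quadrant to the first and preserves the
    -- bounds.
    · have hd : Differentiable ℂ fun w => conj (g (-conj w)) := by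
        have h3 : Differentiable ℂ fun w => g (-w) := hg.comp differentiable_neg
        intro w
        have h4 := (h3 (conj w)).conj_conj
        rw [Complex.conj_conj] at h4
        exact h4
      have := norm_le_pow_of_quadrant (f := fun w => conj (g (-conj w))) (z := -conj z) hb hd
        (fun w => by simpa using hgb (-conj w)) (fun x => by simpa using hgr (-x))
        (by simpa using h) (by simpa using hz)
      simpa using this
  rcases le_total 0 z.im with h | h
  · exact upper f hf hbd hre z h
  · have := upper (fun w => f (-w)) (hf.comp differentiable_neg) (fun w => by simpa using hbd (-w))
      (fun x => by simpa using hre (-x)) (-z) (by simpa using h)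
    simpa using this

theorem iteratedDeriv_eq_zero_of_norm_le_pow {f : ℂ → ℂ} {C : ℝ} {M : ℕ}
    (hf : Differentiable ℂ f) (hbd : ∀ z : ℂ, ‖f z‖ ≤ C * (1 + ‖z‖) ^ M) (z : ℂ) :
    iteratedDeriv (M + 1) f z = 0 := by
  have hC : 0 ≤ C := by simpa using (norm_nonneg _).trans (hbd 0)
  set A := (M + 1).factorial * (C * (2 + ‖z‖) ^ M) with hA
  have hA0 : 0 ≤ A := by positivity
  have key : ∀ R : ℝ, 1 ≤ R → ‖iteratedDeriv (M + 1) f z‖ ≤ A / R := by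
    intro R hR
    have hR0 : 0 < R := by linarith
    have := norm_iteratedDeriv_le_of_forall_mem_sphere_norm_le (c := z) (M + 1) hR0
      hf.diffContOnCl (C := C * ((2 + ‖z‖) * R) ^ M) (fun w hw => by
        refine (hbd w).trans ?_
        have hw' : ‖w - z‖ = R := by simpa [dist_eq_norm] using hw
        have : ‖w‖ ≤ R + ‖z‖ := by
          have := norm_add_le (w - z) z
          rwa [sub_add_cancel, hw'] at this
        gcongr
        nlinarith [norm_nonneg z])
    refine this.trans (le_of_eq ?_)
    rw [hA, mul_pow, pow_succ]
    field_simp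
  have hlim : Tendsto (fun R : ℝ => A / R) atTop (𝓝 0) := tendsto_const_nhds.div_atTop tendsto_id
  have h0 : ‖iteratedDeriv (M + 1) f z‖ ≤ 0 :=
    ge_of_tendsto hlim ((eventually_ge_atTop 1).mono key)
  simpa using h0

theorem iteratedDeriv_comp_ofReal {f : ℂ → ℂ} (hf : Differentiable ℂ f) (n : ℕ) (x : ℝ) :
    iteratedDeriv n (fun t : ℝ => f t) x = iteratedDeriv n f x := by
  induction n generalizing f with
  | zero => simp
  | succ n ih =>
    rw [iteratedDeriv_succ', iteratedDeriv_succ', ← ih]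
    · congr 1
      ext t
      exact ((hf t).hasDerivAt.comp_ofReal).deriv
    · exact fun z => (hf.analyticAt z).deriv.differentiableAt

/-- The Gaussian factor has modulus `exp((π/2)(2 Re w + c)² - 2π (Im w)²)`. It cancels the growth of
`Φ` in `Im w`, leaving a bound of the form required by `norm_le_pow_of_entire`. On the real line
only an integral bound is known, so the argument runs on a primitive of the product. -/
theorem hardy_iteratedDeriv_eq_zero {Φ : ℂ → ℂ} (hΦ : Differentiable ℂ Φ) {C c : ℝ} {M K : ℕ}
    (hbd : ∀ z : ℂ, ‖Φ z‖ ≤ C * (1 + z.im ^ 2) ^ M * Real.exp (2 * Real.pi * z.im ^ 2))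
    (hint : Integrable fun x : ℝ => ‖Φ x‖ ^ 2 * gaussWeight K |2 * x + c|) (z : ℂ) :
    iteratedDeriv (2 * M + K + 1)
      (fun w => Φ w * Complex.exp (Real.pi / 2 * (2 * w + c) ^ 2)) z = 0 := by
  have hpi := Real.pi_pos
  have hC : 0 ≤ C := by simpa using (norm_nonneg _).trans (hbd 0)
  set G : ℂ → ℂ := fun w => Φ w * Complex.exp (Real.pi / 2 * (2 * w + c) ^ 2) with hG
  have hGd : Differentiable ℂ G := by fun_prop
  have hGn : ∀ w : ℂ, ‖G w‖ = ‖Φ w‖ *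
      Real.exp (Real.pi / 2 * ((2 * w.re + c) ^ 2 - 4 * w.im ^ 2)) := fun w => by
    rw [hG, norm_mul, Complex.norm_exp]
    congr 2
    simp [pow_two]
    ring
  have hGb : ∀ w : ℂ, ‖G w‖ ≤ C * Real.exp (Real.pi * c ^ 2) * (1 + ‖w‖) ^ (2 * M) *
      Real.exp (4 * Real.pi * w.re ^ 2) := fun w => by
    have him : (1 + w.im ^ 2) ^ M ≤ (1 + ‖w‖) ^ (2 * M) := by
      rw [pow_mul]
      have h1 : |w.im| ≤ ‖w‖ := abs_im_le_norm w
      have h2 : w.im ^ 2 ≤ ‖w‖ ^ 2 := by rw [← sq_abs]; gcongr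
      gcongr
      nlinarith [norm_nonneg w]
    rw [hGn]
    calc _ ≤ C * (1 + w.im ^ 2) ^ M * Real.exp (2 * Real.pi * w.im ^ 2) *
          Real.exp (Real.pi / 2 * ((2 * w.re + c) ^ 2 - 4 * w.im ^ 2)) := by
          gcongr; exact hbd w
      _ = C * (1 + w.im ^ 2) ^ M * Real.exp (Real.pi / 2 * (2 * w.re + c) ^ 2) := by
          rw [mul_assoc, ← Real.exp_add]; congr 2; ring
      _ ≤ C * (1 + ‖w‖) ^ (2 * M) *
          Real.exp (Real.pi * c ^ 2 + 4 * Real.pi * w.re ^ 2) := by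
          gcongr
          nlinarith [mul_nonneg hpi.le (sq_nonneg (2 * w.re - c))]
      _ = _ := by rw [Real.exp_add]; ring
  -- `‖G x‖²` is the product of the two terms on the right.
  have hGr : ∀ x : ℝ, ‖G x‖ ≤ ‖Φ x‖ ^ 2 * gaussWeight K |2 * x + c| + (1 + |2 * x + c|) ^ K := by
    intro x
    have h1 : ‖G x‖ ^ 2 = ‖Φ x‖ ^ 2 * gaussWeight K |2 * x + c| * (1 + |2 * x + c|) ^ K := by
      rw [hGn, mul_pow, ← Real.exp_nat_mul, gaussWeight, mul_assoc,
        div_mul_cancel₀ _ (by positivity), sq_abs]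
      congr 2
      simp
      ring
    set X := ‖Φ x‖ ^ 2 * gaussWeight K |2 * x + c|
    have hX : 0 ≤ X := mul_nonneg (by positivity) (gaussWeight_nonneg K (abs_nonneg _))
    have hY : 0 ≤ (1 + |2 * x + c|) ^ K := by positivity
    refine abs_le_of_sq_le_sq' ?_ (by positivity) |>.2
    rw [h1]
    nlinarith
  -- The primitive vanishing at `0` turns the integral bound on `G` into a pointwise polynomial
  -- bound on the real line.
  obtain ⟨H, hH0, hH⟩ := hGd.isExactOn_univ.with_val_at 0 0
  replace hH : ∀ w, HasDerivAt H (G w) w := fun w => hH w trivial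
  have hHd : Differentiable ℂ H := fun w => (hH w).differentiableAt
  set I := ∫ x : ℝ, ‖Φ x‖ ^ 2 * gaussWeight K |2 * x + c| with hI
  have hI0 : 0 ≤ I := integral_nonneg fun x =>
    mul_nonneg (by positivity) (gaussWeight_nonneg K (abs_nonneg _))
  have hseg : ∀ w : ℂ, ‖H w‖ ≤ C * Real.exp (Real.pi * c ^ 2) * (1 + ‖w‖) ^ (2 * M) *
      Real.exp (4 * Real.pi * w.re ^ 2) * ‖w‖ := by
    intro w
    have := (convex_segment (0 : ℂ) w).norm_image_sub_le_of_norm_hasDerivWithin_le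
      (f := H) (f' := G) (C := C * Real.exp (Real.pi * c ^ 2) * (1 + ‖w‖) ^ (2 * M) *
      Real.exp (4 * Real.pi * w.re ^ 2)) (fun y _ => (hH y).hasDerivWithinAt) (fun y hy => ?_)
      (left_mem_segment ℝ 0 w) (right_mem_segment ℝ 0 w)
    · simpa [hH0] using this
    · rw [segment_eq_image] at hy
      obtain ⟨t, ⟨ht0, ht1⟩, rfl⟩ := hy
      refine (hGb _).trans ?_
      have e1 : ‖(1 - t) • (0 : ℂ) + t • w‖ ≤ ‖w‖ := by
        simp only [smul_zero, zero_add, norm_smul, Real.norm_of_nonneg ht0]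
        exact mul_le_of_le_one_left (norm_nonneg _) ht1
      have e2 : ((1 - t) • (0 : ℂ) + t • w).re ^ 2 ≤ w.re ^ 2 := by
        simp only [smul_zero, zero_add, real_smul, re_ofReal_mul, mul_pow]
        exact mul_le_of_le_one_left (sq_nonneg _) (by nlinarith)
      gcongr
  have hreal : ∀ x : ℝ, ‖H x‖ ≤ I + |x| * (1 + 2 * |x| + |c|) ^ K := by
    intro x
    have hftc : H x = ∫ t in (0 : ℝ)..x, G t := by
      have := intervalIntegral.integral_eq_sub_of_hasDerivAt (a := 0) (b := x)
        (fun t _ => (hH (t : ℂ)).comp_ofReal)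
        ((hGd.continuous.comp continuous_ofReal).intervalIntegrable 0 x)
      rw [this]; simp [hH0]
    rw [hftc]
    refine intervalIntegral.norm_integral_le_integral_norm_uIoc.trans ?_
    have hvol : volume.real (Set.uIoc 0 x) = |x| := by simp [Measure.real, Real.volume_uIoc]
    have hfin : volume (Set.uIoc 0 x) ≠ ∞ := by simp [Real.volume_uIoc]
    calc ∫ t in Set.uIoc 0 x, ‖G t‖
        ≤ ∫ t in Set.uIoc 0 x, (‖Φ t‖ ^ 2 * gaussWeight K |2 * t + c| +
          (1 + 2 * |x| + |c|) ^ K) := by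
          refine setIntegral_mono_on ?_ ?_ measurableSet_uIoc fun t ht => ?_
          · have hc : Continuous fun t : ℝ => ‖G t‖ :=
              (hGd.continuous.comp continuous_ofReal).norm
            exact (intervalIntegrable_iff.1 (hc.intervalIntegrable 0 x))
          · exact hint.integrableOn.add (integrableOn_const hfin)
          · refine (hGr t).trans ?_
            have ht' : |t| ≤ |x| := by
              rcases Set.mem_uIoc.1 ht with h | h
              · rw [abs_of_pos h.1, abs_of_pos (h.1.trans_le h.2)]; exact h.2
              · rw [abs_of_nonpos h.2, abs_of_neg (h.1.trans_le h.2)]; linarith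
            have : |2 * t + c| ≤ 2 * |x| + |c| := by
              refine (abs_add_le _ _).trans ?_
              rw [abs_mul, abs_two]
              linarith
            have : (1 + |2 * t + c|) ^ K ≤ (1 + 2 * |x| + |c|) ^ K :=
              pow_le_pow_left₀ (by positivity) (by linarith) K
            linarith
      _ = (∫ t in Set.uIoc 0 x, ‖Φ t‖ ^ 2 * gaussWeight K |2 * t + c|) +
          |x| * (1 + 2 * |x| + |c|) ^ K := by
          rw [integral_add hint.integrableOn (integrableOn_const hfin), setIntegral_const, hvol,
            smul_eq_mul]
      _ ≤ _ := by
          gcongr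
          exact setIntegral_le_integral hint (.of_forall fun x =>
            mul_nonneg (by positivity) (gaussWeight_nonneg K (abs_nonneg _)))
  set A := C * Real.exp (Real.pi * c ^ 2) + I + (2 + |c|) ^ K with hA
  have hA1 : C * Real.exp (Real.pi * c ^ 2) ≤ A := by
    have : 0 ≤ (2 + |c|) ^ K := by positivity
    linarith
  have hA0 : 0 ≤ A := le_trans (by positivity) hA1
  have hpow := norm_le_pow_of_entire (C := A) (b := 4 * Real.pi) (M := 2 * M + K + 1)
    (by positivity) hHd (fun w => ?_) (fun x => ?_)
  · have := iteratedDeriv_eq_zero_of_norm_le_pow hHd hpow z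
    -- `H` has degree at most `2M + K + 1`, so its derivative of order `2M + K + 2` vanishes; one of
    -- these derivatives turns `H` into `G`.
    rw [iteratedDeriv_succ'] at this
    rwa [show deriv H = G from funext fun w => (hH w).deriv] at this
  · refine (hseg w).trans ?_
    have h1 : 1 ≤ (1 + ‖w‖) ^ K := one_le_pow₀ (by linarith [norm_nonneg w])
    calc C * Real.exp (Real.pi * c ^ 2) * (1 + ‖w‖) ^ (2 * M) *
          Real.exp (4 * Real.pi * w.re ^ 2) * ‖w‖
        ≤ A * (1 + ‖w‖) ^ (2 * M) * Real.exp (4 * Real.pi * w.re ^ 2) *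
          ((1 + ‖w‖) * (1 + ‖w‖) ^ K) := by
          gcongr
          nlinarith [norm_nonneg w]
      _ = _ := by ring
  · refine (hreal x).trans ?_
    have hx := abs_nonneg x
    have h1 : (1 + 2 * |x| + |c|) ^ K ≤ (2 + |c|) ^ K * (1 + |x|) ^ K := by
      rw [← mul_pow]
      gcongr
      nlinarith [abs_nonneg c]
    have h2 : 1 ≤ (1 + |x|) ^ (2 * M + K + 1) := one_le_pow₀ (by linarith)
    have h3 : |x| * (1 + |x|) ^ K ≤ (1 + |x|) ^ (2 * M + K + 1) := by
      calc |x| * (1 + |x|) ^ K ≤ (1 + |x|) * (1 + |x|) ^ K := by gcongr; linarith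
        _ = (1 + |x|) ^ (K + 1) := by ring
        _ ≤ _ := pow_le_pow_right₀ (by linarith) (by omega)
    calc I + |x| * (1 + 2 * |x| + |c|) ^ K
        ≤ I * (1 + |x|) ^ (2 * M + K + 1) +
          (2 + |c|) ^ K * (1 + |x|) ^ (2 * M + K + 1) := by
          have e1 : I ≤ I * (1 + |x|) ^ (2 * M + K + 1) := le_mul_of_one_le_right hI0 h2
          have e2 : |x| * (1 + 2 * |x| + |c|) ^ K ≤ (2 + |c|) ^ K * (|x| * (1 + |x|) ^ K) := by
            calc _ ≤ |x| * ((2 + |c|) ^ K * (1 + |x|) ^ K) := by gcongr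
              _ = _ := by ring
          have e3 : (2 + |c|) ^ K * (|x| * (1 + |x|) ^ K) ≤
              (2 + |c|) ^ K * (1 + |x|) ^ (2 * M + K + 1) := by gcongr
          linarith
      _ = (I + (2 + |c|) ^ K) * (1 + |x|) ^ (2 * M + K + 1) := by ring
      _ ≤ _ := by
          gcongr
          have : 0 ≤ C * Real.exp (Real.pi * c ^ 2) := by positivity
          linarith

end CriticalPhragmenLindelof

/-! ### Restriction to lines and analytic extension along them -/

/-- Integrating the line integral over all base points would count each line infinitely often. The
positive weight `exp(-(ℓ x)²)`, integrable along `b` because `ℓ b ≠ 0`, makes the total finite,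
equal to a constant times `∫ H`. -/
theorem ae_lintegral_line_lt_top {X : Type*} [NormedAddCommGroup X] [NormedSpace ℝ X]
    [MeasurableSpace X] [BorelSpace X] [SecondCountableTopology X] (μ : Measure X) [SFinite μ]
    [μ.IsAddRightInvariant] {H : X → ℝ≥0∞} (hH : Measurable H) (hfin : ∫⁻ x, H x ∂μ ≠ ∞)
    {b : X} {ℓ : X →L[ℝ] ℝ} (hℓ : ℓ b ≠ 0) : ∀ᵐ x ∂μ, ∫⁻ σ : ℝ, H (x + σ • b) < ∞ := by
  set ρ : ℝ → ℝ≥0∞ := fun c => ENNReal.ofReal (Real.exp (-c ^ 2)) with hρ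
  have hρm : Measurable ρ := by fun_prop
  have hinner : ∀ x : X, ∫⁻ σ : ℝ, ρ (ℓ x - σ * ℓ b) = ∫⁻ σ : ℝ, ρ (σ * ℓ b) := by
    intro x
    rw [← lintegral_add_right_eq_self _ (ℓ x / ℓ b)]
    refine lintegral_congr fun σ => ?_
    rw [add_mul, div_mul_cancel₀ _ hℓ, hρ]
    simp
  have hC : ∫⁻ σ : ℝ, ρ (σ * ℓ b) < ∞ := by
    have h1 : Integrable fun σ : ℝ => Real.exp (-(ℓ b) ^ 2 * σ ^ 2) :=
      integrable_exp_neg_mul_sq (by positivity)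
    refine lt_of_eq_of_lt (lintegral_congr fun σ => ?_)
      ((hasFiniteIntegral_iff_ofReal (.of_forall fun σ => (Real.exp_pos _).le)).1 h1.2)
    rw [hρ]
    ring_nf
  have hmeas : Measurable fun x => ∫⁻ σ : ℝ, H (x + σ • b) :=
    Measurable.lintegral_prod_right' (f := fun z : X × ℝ => H (z.1 + z.2 • b)) (by fun_prop)
  have key : ∫⁻ x, (ρ (ℓ x) * ∫⁻ σ : ℝ, H (x + σ • b)) ∂μ < ∞ := by
    calc ∫⁻ x, (ρ (ℓ x) * ∫⁻ σ : ℝ, H (x + σ • b)) ∂μ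
        = ∫⁻ x, (∫⁻ σ : ℝ, ρ (ℓ x) * H (x + σ • b)) ∂μ :=
          lintegral_congr fun x => (lintegral_const_mul _ (by fun_prop)).symm
      _ = ∫⁻ σ : ℝ, ∫⁻ x, ρ (ℓ x) * H (x + σ • b) ∂μ :=
          lintegral_lintegral_swap (by fun_prop)
      _ = ∫⁻ σ : ℝ, ∫⁻ x, ρ (ℓ x - σ * ℓ b) * H x ∂μ := by
          refine lintegral_congr fun σ => ?_
          rw [← lintegral_add_right_eq_self (fun x => ρ (ℓ x - σ * ℓ b) * H x) (σ • b)]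
          simp
      _ = ∫⁻ x, (∫⁻ σ : ℝ, ρ (ℓ x - σ * ℓ b) * H x) ∂μ :=
          lintegral_lintegral_swap (by fun_prop)
      _ = ∫⁻ x, (∫⁻ σ : ℝ, ρ (σ * ℓ b)) * H x ∂μ := by
          refine lintegral_congr fun x => ?_
          rw [lintegral_mul_const _ (by fun_prop), hinner]
      _ = (∫⁻ σ : ℝ, ρ (σ * ℓ b)) * ∫⁻ x, H x ∂μ := lintegral_const_mul _ hH
      _ < ∞ := ENNReal.mul_lt_top hC hfin.lt_top
  filter_upwards [ae_lt_top (by fun_prop) key.ne] with x hx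
  by_contra hc
  rw [not_lt_top_iff] at hc
  rw [hc, ENNReal.mul_top (by simp [hρ, Real.exp_pos])] at hx
  exact lt_irrefl _ hx

section InnerBounds

variable {V : Type*} [NormedAddCommGroup V] [InnerProductSpace ℝ V]

theorem norm_exp_fourierExt (e s ξ : V) (τ : ℂ) :
    ‖Complex.exp (2 * Real.pi * Complex.I * (⟪ξ, s⟫_ℝ + ⟪ξ, e⟫_ℝ * τ))‖ =
      Real.exp (-(2 * Real.pi * τ.im * ⟪ξ, e⟫_ℝ)) := by
  rw [Complex.norm_exp]
  congr 1
  simp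
  ring

theorem abs_inner_le_norm_of_unit {e : V} (he : ‖e‖ = 1) (ξ : V) : |⟪ξ, e⟫_ℝ| ≤ ‖ξ‖ := by
  simpa [he] using abs_real_inner_le_norm ξ e

theorem neg_mul_inner_le {e : V} (he : ‖e‖ = 1) (ξ : V) {a R : ℝ} (ha : |a| ≤ R) :
    -(2 * Real.pi * a * ⟪ξ, e⟫_ℝ) ≤ 2 * Real.pi * R * ‖ξ‖ := by
  have h1 : |a * ⟪ξ, e⟫_ℝ| ≤ R * ‖ξ‖ := by
    rw [abs_mul]
    exact mul_le_mul ha (abs_inner_le_norm_of_unit he ξ) (abs_nonneg _) ((abs_nonneg _).trans ha)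
  have h2 := neg_le_of_abs_le h1
  nlinarith [Real.pi_pos]

end InnerBounds

section FourierExtension

variable {V : Type*} [NormedAddCommGroup V] [InnerProductSpace ℝ V] [FiniteDimensional ℝ V]
  [MeasurableSpace V] [BorelSpace V]

/-- The extension of the inverse Fourier transform of `φ` to complex arguments along the line
through `s` with direction `e`. -/
noncomputable def fourierExt (φ : V → ℂ) (e s : V) (τ : ℂ) : ℂ :=
  ∫ ξ, φ ξ * Complex.exp (2 * Real.pi * Complex.I * (⟪ξ, s⟫_ℝ + ⟪ξ, e⟫_ℝ * τ))

theorem fourierExt_ofReal (φ : V → ℂ) (e s : V) (σ : ℝ) :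
    fourierExt φ e s σ = 𝓕⁻ φ (s + σ • e) := by
  rw [fourierExt, Real.fourierInv_eq]
  refine integral_congr_ae (.of_forall fun ξ => ?_)
  simp only [Circle.smul_def, smul_eq_mul, Real.fourierChar_apply, inner_add_right,
    inner_smul_right]
  rw [mul_comm]
  push_cast
  ring_nf

theorem integrable_fourierExt {φ : V → ℂ} (hφ : Measurable φ)
    (hint : ∀ c : ℝ, Integrable fun ξ => ‖φ ξ‖ * Real.exp (c * ‖ξ‖)) {e : V} (he : ‖e‖ = 1)
    (s : V) (τ : ℂ) :
    Integrable fun ξ =>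
      φ ξ * Complex.exp (2 * Real.pi * Complex.I * (⟪ξ, s⟫_ℝ + ⟪ξ, e⟫_ℝ * τ)) := by
  refine (hint (2 * Real.pi * |τ.im|)).mono' (by fun_prop) (.of_forall fun ξ => ?_)
  rw [norm_mul, norm_exp_fourierExt]
  gcongr
  exact neg_mul_inner_le he ξ le_rfl

theorem differentiable_fourierExt {φ : V → ℂ} (hφ : Measurable φ)
    (hint : ∀ c : ℝ, Integrable fun ξ => ‖φ ξ‖ * Real.exp (c * ‖ξ‖)) {e : V} (he : ‖e‖ = 1)
    (s : V) : Differentiable ℂ (fourierExt φ e s) := by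
  intro τ
  have := hasDerivAt_integral_of_dominated_loc_of_deriv_le (μ := (volume : Measure V))
    (F := fun (τ : ℂ) ξ => φ ξ *
      Complex.exp (2 * Real.pi * Complex.I * (⟪ξ, s⟫_ℝ + ⟪ξ, e⟫_ℝ * τ)))
    (F' := fun (τ : ℂ) ξ => φ ξ *
      (Complex.exp (2 * Real.pi * Complex.I * (⟪ξ, s⟫_ℝ + ⟪ξ, e⟫_ℝ * τ)) *
        (2 * Real.pi * Complex.I * ⟪ξ, e⟫_ℝ)))
    (x₀ := τ) (s := Metric.ball τ 1)
    (bound := fun ξ => ‖φ ξ‖ * Real.exp ((2 * Real.pi * (|τ.im| + 1) + 2 * Real.pi) * ‖ξ‖))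
    (Metric.ball_mem_nhds τ one_pos)
    (.of_forall fun w => (integrable_fourierExt hφ hint he s w).1)
    (integrable_fourierExt hφ hint he s τ) (by fun_prop)
    (.of_forall fun ξ w hw => ?_) (hint _) (.of_forall fun ξ w _ => ?_)
  · exact this.2.differentiableAt
  · rw [norm_mul, norm_mul, norm_exp_fourierExt, add_mul, Real.exp_add]
    have h1 : |w.im| ≤ |τ.im| + 1 := by
      have h2 : |w.im - τ.im| < 1 := by
        refine lt_of_le_of_lt ?_ (mem_ball_iff_norm.1 hw)
        simpa using Complex.abs_im_le_norm (w - τ)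
      have := abs_add_le (w.im - τ.im) τ.im
      rw [sub_add_cancel] at this
      linarith
    gcongr
    · exact neg_mul_inner_le he ξ h1
    · have h3 : ‖(2 * Real.pi * Complex.I * ⟪ξ, e⟫_ℝ : ℂ)‖ = 2 * Real.pi * |⟪ξ, e⟫_ℝ| := by
        simp [abs_of_pos Real.pi_pos]
      rw [h3]
      have h4 : 2 * Real.pi * |⟪ξ, e⟫_ℝ| ≤ 2 * Real.pi * ‖ξ‖ := by
        gcongr; exact abs_inner_le_norm_of_unit he ξ
      linarith [Real.add_one_le_exp (2 * Real.pi * ‖ξ‖)]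
  · have h1 : HasDerivAt (fun w : ℂ => 2 * Real.pi * Complex.I * (⟪ξ, s⟫_ℝ + ⟪ξ, e⟫_ℝ * w))
        (2 * Real.pi * Complex.I * ⟪ξ, e⟫_ℝ) w := by
      have := (((hasDerivAt_id w).const_mul (⟪ξ, e⟫_ℝ : ℂ)).const_add (⟪ξ, s⟫_ℝ : ℂ)).const_mul
        (2 * Real.pi * Complex.I)
      simpa using this
    exact h1.cexp.const_mul _

/-- The opposite arguments `τ` and `-τ` make the growth depend only on the difference of the two
frequencies, the quantity the weight controls. -/
theorem norm_fourierExt_mul_le {φ ψ : V → ℂ} {e : V} (he : ‖e‖ = 1) (s t : V) (τ : ℂ)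
    (hint : Integrable fun z : V × V => ‖φ z.1‖ * ‖ψ z.2‖ *
        Real.exp (2 * Real.pi * |τ.im| * ‖z.1 - z.2‖)) :
    ‖fourierExt φ e s τ * fourierExt ψ e t (-τ)‖ ≤
      ∫ z : V × V, ‖φ z.1‖ * ‖ψ z.2‖ * Real.exp (2 * Real.pi * |τ.im| * ‖z.1 - z.2‖) := by
  rw [fourierExt, fourierExt, ← integral_prod_mul]
  refine norm_integral_le_of_norm_le hint (.of_forall fun z => ?_)
  rw [norm_mul, norm_mul, norm_mul, norm_exp_fourierExt, norm_exp_fourierExt]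
  have h1 : Real.exp (-(2 * Real.pi * τ.im * ⟪z.1, e⟫_ℝ)) *
      Real.exp (-(2 * Real.pi * (-τ).im * ⟪z.2, e⟫_ℝ)) =
      Real.exp (-(2 * Real.pi * τ.im * ⟪z.1 - z.2, e⟫_ℝ)) := by
    rw [← Real.exp_add, inner_sub_left, Complex.neg_im]
    ring_nf
  calc _ = ‖φ z.1‖ * ‖ψ z.2‖ * (Real.exp (-(2 * Real.pi * τ.im * ⟪z.1, e⟫_ℝ)) *
      Real.exp (-(2 * Real.pi * (-τ).im * ⟪z.2, e⟫_ℝ))) := by ring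
    _ ≤ _ := by
      rw [h1]
      gcongr
      exact neg_mul_inner_le he _ le_rfl

/-- The one-variable theorem on almost every line in direction `(e, -e)`. The order `n` depends only
on the growth exponents, hence not on the line. -/
theorem hardy_slices {p q : V → ℂ} (hp : Measurable p) (hq : Measurable q) {K : ℕ}
    (h : Integrable fun z : V × V => (‖p z.1‖ * ‖q z.2‖) ^ 2 * gaussWeight K ‖z.1 - z.2‖)
    (hp2 : Integrable fun s => ‖p s‖ ^ 2 * Real.exp (‖s‖ ^ 2))
    (hq2 : Integrable fun s => ‖q s‖ ^ 2 * Real.exp (‖s‖ ^ 2))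
    (hpc : Continuous (𝓕⁻ p)) (hqc : Continuous (𝓕⁻ q))
    (h' : Integrable fun z : V × V =>
      (‖𝓕⁻ p z.1‖ * ‖𝓕⁻ q z.2‖) ^ 2 * gaussWeight K ‖z.1 - z.2‖)
    {e : V} (he : ‖e‖ = 1) :
    ∃ n : ℕ, ∀ᵐ z : V × V, iteratedDeriv n (fun σ : ℝ =>
      𝓕⁻ p (z.1 + σ • e) * 𝓕⁻ q (z.2 - σ • e) *
        Complex.exp (Real.pi / 2 * (2 * (σ : ℂ) + (⟪z.1 - z.2, e⟫_ℝ : ℝ)) ^ 2)) 0 = 0 := by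
  obtain ⟨C, hC, M, hM⟩ := exists_integral_prod_mul_exp_le hp hq h hp2 hq2
  refine ⟨2 * M + K + 1, ?_⟩
  -- `ℓ` takes the value `2` on `(e, -e)`, so it is transversal to the lines and equals `2σ + c`
  -- along them.
  set ℓ : V × V →L[ℝ] ℝ := (innerSL ℝ e).comp
    (ContinuousLinearMap.fst ℝ V V - ContinuousLinearMap.snd ℝ V V) with hℓ
  have hℓv : ∀ z : V × V, ℓ z = ⟪z.1 - z.2, e⟫_ℝ := fun z => by
    rw [real_inner_comm]; simp [hℓ, inner_sub_right]
  have hℓb : ℓ (e, -e) = 2 := by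
    rw [hℓv, sub_neg_eq_add, inner_add_left, real_inner_self_eq_norm_sq, he]; norm_num
  set H : V × V → ℝ := fun z => (‖𝓕⁻ p z.1‖ * ‖𝓕⁻ q z.2‖) ^ 2 * gaussWeight K |ℓ z| with hH
  have hHm : Measurable H := by
    have : Measurable fun z => gaussWeight K |ℓ z| :=
      (measurable_gaussWeight K).comp (by fun_prop)
    fun_prop
  have hH0 : ∀ z, 0 ≤ H z := fun z =>
    mul_nonneg (by positivity) (gaussWeight_nonneg K (abs_nonneg _))
  have hHint : Integrable H := by
    refine (h'.const_mul (K.factorial * Real.exp 2)).mono' hHm.aestronglyMeasurable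
      (.of_forall fun z => ?_)
    rw [Real.norm_of_nonneg (hH0 z)]
    have := gaussWeight_le_mul_of_le K (abs_nonneg (ℓ z))
      (by rw [hℓv]; exact abs_inner_le_norm_of_unit he _ : |ℓ z| ≤ ‖z.1 - z.2‖)
    calc H z ≤ (‖𝓕⁻ p z.1‖ * ‖𝓕⁻ q z.2‖) ^ 2 *
          (K.factorial * Real.exp 2 * gaussWeight K ‖z.1 - z.2‖) :=
          mul_le_mul_of_nonneg_left this (by positivity)
      _ = _ := by ring
  have : (volume : Measure (V × V)).IsAddRightInvariant := by
    rw [Measure.volume_eq_prod]; infer_instance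
  have hae := ae_lintegral_line_lt_top (volume : Measure (V × V)) hHm.ennreal_ofReal
    ((hasFiniteIntegral_iff_ofReal (.of_forall hH0)).1 hHint.2).ne
    (b := (e, -e)) (ℓ := ℓ) (by rw [hℓb]; norm_num)
  filter_upwards [hae] with z hz
  have hpe := fun c => integrable_norm_mul_exp_of_sq hp.aestronglyMeasurable hp2 c
  have hqe := fun c => integrable_norm_mul_exp_of_sq hq.aestronglyMeasurable hq2 c
  set Φ : ℂ → ℂ := fun τ => fourierExt p e z.1 τ * fourierExt q e z.2 (-τ) with hΦ
  have hΦd : Differentiable ℂ Φ := (differentiable_fourierExt hp hpe he z.1).mul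
    ((differentiable_fourierExt hq hqe he z.2).comp differentiable_neg)
  have hΦr : ∀ σ : ℝ, Φ σ = 𝓕⁻ p (z.1 + σ • e) * 𝓕⁻ q (z.2 - σ • e) := fun σ => by
    rw [hΦ]
    dsimp only
    rw [← Complex.ofReal_neg, fourierExt_ofReal, fourierExt_ofReal, neg_smul, sub_eq_add_neg]
  have hslice : ∀ σ : ℝ, ‖Φ σ‖ ^ 2 * gaussWeight K |2 * σ + ⟪z.1 - z.2, e⟫_ℝ| =
      H (z + σ • (e, -e)) := fun σ => by
    rw [hΦr, norm_mul, hH]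
    dsimp only
    rw [map_add, map_smul, hℓb, hℓv, smul_eq_mul, mul_comm σ, add_comm (2 * σ)]
    simp [sub_eq_add_neg]
  have hzero := hardy_iteratedDeriv_eq_zero hΦd (C := C) (c := ⟪z.1 - z.2, e⟫_ℝ) (M := M)
    (K := K) (fun τ => ?_) ?_ 0
  · have hd : Differentiable ℂ fun w : ℂ =>
        Φ w * Complex.exp (Real.pi / 2 * (2 * w + (⟪z.1 - z.2, e⟫_ℝ : ℝ)) ^ 2) := by fun_prop
    have := iteratedDeriv_comp_ofReal hd (2 * M + K + 1) 0
    rw [Complex.ofReal_zero, hzero] at this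
    simpa only [hΦr] using this
  · have h1 := hM |τ.im|
    have := norm_fourierExt_mul_le he z.1 z.2 τ h1.1
    rw [sq_abs] at h1
    exact this.trans h1.2
  · simp_rw [hslice]
    refine ⟨Measurable.aestronglyMeasurable (by fun_prop), ?_⟩
    rw [hasFiniteIntegral_iff_ofReal (.of_forall fun σ => hH0 _)]
    exact hz

end FourierExtension

/-! ### Generalized eigenvectors from a tensor identity -/

section LinearAlgebra

open Polynomial

variable {S : Type*} [AddCommGroup S] [Module ℂ S]

/-- Strip linear factors from `p` until the remaining quotient no longer kills `f`; the last factor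
stripped gives the eigenvalue. -/
theorem exists_aeval_eigenvector (D : Module.End ℂ S) {f : S} (hf : f ≠ 0) {p : ℂ[X]}
    (hp : p ≠ 0) (h : aeval D p f = 0) :
    ∃ q : ℂ[X], ∃ μ : ℂ, aeval D q f ≠ 0 ∧ D (aeval D q f) = μ • aeval D q f := by
  induction hn : p.natDegree using Nat.strong_induction_on generalizing p with
  | _ n ih =>
    rcases Nat.eq_zero_or_pos n with h0 | h0
    · rw [h0] at hn
      rw [eq_C_of_natDegree_eq_zero hn, aeval_C, Module.algebraMap_end_apply] at h
      rw [eq_C_of_natDegree_eq_zero hn, Ne, C_eq_zero] at hp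
      exact absurd h (smul_ne_zero hp hf)
    · obtain ⟨μ, hμ⟩ := IsAlgClosed.exists_root p
        (by rw [degree_eq_natDegree hp, hn]; exact_mod_cast h0.ne')
      obtain ⟨q, rfl⟩ := dvd_iff_isRoot.2 hμ
      have hq0 : q ≠ 0 := right_ne_zero_of_mul hp
      by_cases hq : aeval D q f = 0
      · refine ih q.natDegree ?_ hq0 hq rfl
        rw [natDegree_mul (X_sub_C_ne_zero μ) hq0, natDegree_X_sub_C] at hn
        omega
      · refine ⟨q, μ, hq, ?_⟩
        rw [map_mul, Module.End.mul_apply, map_sub, aeval_X, aeval_C, LinearMap.sub_apply,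
          Module.algebraMap_end_apply, sub_eq_zero] at h
        exact h

theorem pow_apply_of_eigenvector {D : Module.End ℂ S} {f : S} {μ : ℂ} (h : D f = μ • f) (k : ℕ) :
    (D ^ k) f = μ ^ k • f := by
  induction k with
  | zero => simp
  | succ k ih => rw [pow_succ', Module.End.mul_apply, ih, map_smul, h, smul_smul, pow_succ]

theorem sub_algebraMap_pow_apply (D : Module.End ℂ S) (μ : ℂ) (n : ℕ) (f : S) :
    ((D - algebraMap ℂ (Module.End ℂ S) μ) ^ n) f =
      ∑ k ∈ Finset.range (n + 1), ((n.choose k : ℂ) * (-μ) ^ (n - k)) • (D ^ k) f := by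
  rw [sub_eq_add_neg, ← map_neg, (Algebra.commute_algebraMap_right (-μ) D).add_pow,
    LinearMap.sum_apply]
  refine Finset.sum_congr rfl fun k _ => ?_
  rw [← map_pow, ← map_natCast (algebraMap ℂ (Module.End ℂ S)), mul_assoc, ← map_mul,
    Module.End.mul_apply, Module.algebraMap_end_apply, map_smul, mul_comm]

/-- The hypothesis is `(D ⊗ 1 - 1 ⊗ D)^n (f ⊗ g) = 0`, evaluated at pairs of points. Fixing `t` with
`g(t) ≠ 0` gives a nonzero polynomial in `D` killing `f`, hence an eigenvector `q(D) f` with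
eigenvalue `μ`. Applying `q(D)` in the first factor replaces `D ⊗ 1` by `μ`, so `(D - μ)^n g = 0`.
The same argument with the roles exchanged treats `f`. -/
theorem exists_generalized_eigenvalue {α : Type*} (D : Module.End ℂ S) (ev : S →ₗ[ℂ] (α → ℂ))
    (hev : Function.Injective ev) {f g : S} (hf : f ≠ 0) (hg : g ≠ 0) {n : ℕ}
    (h : ∀ s t, ∑ k ∈ Finset.range (n + 1), (n.choose k : ℂ) * ev ((D ^ k) f) s *
      ((-1) ^ (n - k) * ev ((D ^ (n - k)) g) t) = 0) :
    ∃ μ : ℂ, ((D - algebraMap ℂ (Module.End ℂ S) μ) ^ n) f = 0 ∧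
      ((D - algebraMap ℂ (Module.End ℂ S) μ) ^ n) g = 0 := by
  have hcomm : ∀ (q : ℂ[X]) (k : ℕ) (x : S), aeval D q ((D ^ k) x) = (D ^ k) (aeval D q x) := by
    intro q k x
    rw [← Module.End.mul_apply, ← Module.End.mul_apply]
    congr 1
    have : (D ^ k) = aeval D (X ^ k : ℂ[X]) := by simp
    rw [this, ← map_mul, ← map_mul, mul_comm]
  have hF : ∀ t, ∑ k ∈ Finset.range (n + 1),
      ((n.choose k : ℂ) * ((-1) ^ (n - k) * ev ((D ^ (n - k)) g) t)) • (D ^ k) f = 0 := by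
    intro t
    refine hev (funext fun s => ?_)
    rw [map_sum, map_zero, Finset.sum_apply, Pi.zero_apply, ← h s t]
    refine Finset.sum_congr rfl fun k _ => ?_
    rw [map_smul, Pi.smul_apply, smul_eq_mul]
    ring
  have hG : ∀ s, ∑ k ∈ Finset.range (n + 1),
      ((n.choose k : ℂ) * ev ((D ^ k) f) s * (-1) ^ (n - k)) • (D ^ (n - k)) g = 0 := by
    intro s
    refine hev (funext fun t => ?_)
    rw [map_sum, map_zero, Finset.sum_apply, Pi.zero_apply, ← h s t]
    refine Finset.sum_congr rfl fun k _ => ?_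
    rw [map_smul, Pi.smul_apply, smul_eq_mul]
    ring
  have right : ∀ (q : ℂ[X]) (μ : ℂ), aeval D q f ≠ 0 → D (aeval D q f) = μ • aeval D q f →
      ((D - algebraMap ℂ (Module.End ℂ S) μ) ^ n) g = 0 := by
    intro q μ hq hμ
    refine hev (funext fun t => ?_)
    have h1 := congrArg (aeval D q) (hF t)
    simp only [map_sum, map_smul, hcomm, pow_apply_of_eigenvector hμ, smul_smul, map_zero] at h1
    rw [← Finset.sum_smul] at h1
    have h2 := (smul_eq_zero.1 h1).resolve_right hq
    rw [sub_algebraMap_pow_apply, map_sum, map_zero, Finset.sum_apply, Pi.zero_apply,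
      ← Finset.sum_range_reflect]
    rw [← mul_zero ((-1) ^ n), ← h2, Finset.mul_sum]
    refine Finset.sum_congr rfl fun k hk => ?_
    have hk' : k ≤ n := Nat.lt_succ_iff.1 (Finset.mem_range.1 hk)
    have e1 : n + 1 - 1 - k = n - k := by omega
    rw [e1, Nat.sub_sub_self hk', Nat.choose_symm hk', map_smul, Pi.smul_apply, smul_eq_mul]
    have e2 : ((-1 : ℂ)) ^ n * (-1) ^ (n - k) = (-1) ^ k := by
      rw [← Nat.sub_add_cancel hk', pow_add, Nat.add_sub_cancel]
      rw [mul_right_comm, ← mul_pow]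
      simp
    rw [neg_pow μ, ← e2]
    ring
  have left : ∀ (q : ℂ[X]) (μ : ℂ), aeval D q g ≠ 0 → D (aeval D q g) = μ • aeval D q g →
      ((D - algebraMap ℂ (Module.End ℂ S) μ) ^ n) f = 0 := by
    intro q μ hq hμ
    refine hev (funext fun s => ?_)
    have h1 := congrArg (aeval D q) (hG s)
    simp only [map_sum, map_smul, hcomm, pow_apply_of_eigenvector hμ, smul_smul, map_zero] at h1
    rw [← Finset.sum_smul] at h1
    have h2 := (smul_eq_zero.1 h1).resolve_right hq
    rw [sub_algebraMap_pow_apply, map_sum, map_zero, Finset.sum_apply, Pi.zero_apply, ← h2]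
    refine Finset.sum_congr rfl fun k _ => ?_
    rw [map_smul, Pi.smul_apply, smul_eq_mul, neg_pow μ]
    ring
  obtain ⟨t, ht⟩ : ∃ t, ev g t ≠ 0 := by
    by_contra hc
    push Not at hc
    exact hg (hev (by rw [map_zero]; exact funext hc))
  set p : ℂ[X] := ∑ k ∈ Finset.range (n + 1),
    C ((n.choose k : ℂ) * ((-1) ^ (n - k) * ev ((D ^ (n - k)) g) t)) * X ^ k with hp
  have hp0 : p ≠ 0 := by
    intro hc
    have := congrArg (fun r => r.coeff n) hc
    simp only [hp, finsetSum_coeff, coeff_C_mul_X_pow, coeff_zero] at this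
    rw [Finset.sum_ite_eq, if_pos (Finset.self_mem_range_succ n)] at this
    exact ht (by simpa using this)
  have hpf : aeval D p f = 0 := by
    rw [← hF t, hp, map_sum, LinearMap.sum_apply]
    refine Finset.sum_congr rfl fun k _ => ?_
    rw [map_mul, aeval_C, map_pow, aeval_X, Module.End.mul_apply, Module.algebraMap_end_apply]
  obtain ⟨q, μ, hq, hμ⟩ := exists_aeval_eigenvector D hf hp0 hpf
  have hgμ := right q μ hq hμ
  refine ⟨μ, ?_, hgμ⟩
  -- An eigenvector `q'(D) g` is also killed by `(D - μ)^n`, which forces its eigenvalue to be the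
  -- same `μ`.
  have hpg : aeval D ((X - C μ) ^ n) g = 0 := by
    rw [map_pow, map_sub, aeval_X, aeval_C]; exact hgμ
  obtain ⟨q', μ', hq', hμ'⟩ := exists_aeval_eigenvector D hg (pow_ne_zero n (X_sub_C_ne_zero μ)) hpg
  have hEq : D (aeval D q' g) = μ • aeval D q' g := by
    have h1 : (D - algebraMap ℂ (Module.End ℂ S) μ) (aeval D q' g) = (μ' - μ) • aeval D q' g := by
      rw [LinearMap.sub_apply, hμ', Module.algebraMap_end_apply, sub_smul]
    have h2 := pow_apply_of_eigenvector h1 n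
    have h3 : ((D - algebraMap ℂ (Module.End ℂ S) μ) ^ n) (aeval D q' g) = 0 := by
      have e : (D - algebraMap ℂ (Module.End ℂ S) μ) ^ n = aeval D ((X - C μ) ^ n) := by
        rw [map_pow, map_sub, aeval_X, aeval_C]
      rw [e, ← Module.End.mul_apply, ← map_mul, mul_comm, map_mul, Module.End.mul_apply, hpg,
        map_zero]
    rw [h3] at h2
    have h4 := (smul_eq_zero.1 h2.symm).resolve_right hq'
    have h5 : μ' = μ := sub_eq_zero.1 (eq_zero_of_pow_eq_zero h4)
    rw [hμ', h5]
  exact left q' μ hq' hEq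

end LinearAlgebra

/-! ### Directional derivatives of smooth functions -/

section DirectionalDerivative

variable {V : Type*} [NormedAddCommGroup V] [NormedSpace ℝ V]

/-- The space of smooth complex-valued functions. -/
def smoothFunctions (V : Type*) [NormedAddCommGroup V] [NormedSpace ℝ V] :
    Submodule ℂ (V → ℂ) where
  carrier := {f | ContDiff ℝ (⊤ : ℕ∞) f}
  add_mem' {f g} (hf : ContDiff ℝ (⊤ : ℕ∞) f) (hg : ContDiff ℝ (⊤ : ℕ∞) g) := hf.add hg
  zero_mem' := show ContDiff ℝ (⊤ : ℕ∞) (fun _ : V => (0 : ℂ)) from contDiff_const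
  smul_mem' c f (hf : ContDiff ℝ (⊤ : ℕ∞) f) := hf.const_smul c

theorem contDiff_smoothFunctions (f : smoothFunctions V) : ContDiff ℝ (⊤ : ℕ∞) (f : V → ℂ) := f.2

theorem differentiable_smoothFunctions (f : smoothFunctions V) :
    Differentiable ℝ (f : V → ℂ) :=
  (contDiff_smoothFunctions f).differentiable (by simp)

/-- The directional derivative as an operator on smooth functions. -/
noncomputable def directionalDeriv (e : V) : Module.End ℂ (smoothFunctions V) where
  toFun f := ⟨fun x => fderiv ℝ (f : V → ℂ) x e,
    show ContDiff ℝ (⊤ : ℕ∞) fun x => fderiv ℝ (f : V → ℂ) x e from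
      ((contDiff_smoothFunctions f).fderiv_right (m := (⊤ : ℕ∞)) (by simp)).clm_apply
        contDiff_const⟩
  map_add' f g := by
    ext x
    simp [fderiv_add (differentiable_smoothFunctions f x) (differentiable_smoothFunctions g x)]
  map_smul' c f := by
    ext x
    simp [fderiv_const_smul (differentiable_smoothFunctions f x)]

theorem hasDerivAt_comp_line (f : smoothFunctions V) (s e : V) (σ : ℝ) :
    HasDerivAt (fun r : ℝ => (f : V → ℂ) (s + r • e))
      ((directionalDeriv e f : V → ℂ) (s + σ • e)) σ := by
  have h1 : HasDerivAt (fun r : ℝ => s + r • e) e σ := by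
    simpa using ((hasDerivAt_id σ).smul_const e).const_add s
  exact (differentiable_smoothFunctions f _).hasFDerivAt.comp_hasDerivAt σ h1

theorem iteratedDeriv_comp_line (f : smoothFunctions V) (s e : V) (n : ℕ) (σ : ℝ) :
    iteratedDeriv n (fun r : ℝ => (f : V → ℂ) (s + r • e)) σ =
      (((directionalDeriv e) ^ n) f : V → ℂ) (s + σ • e) := by
  induction n generalizing f with
  | zero => simp
  | succ n ih =>
    rw [iteratedDeriv_succ', pow_succ, Module.End.mul_apply, ← ih]
    congr 1
    exact funext fun r => (hasDerivAt_comp_line f s e r).deriv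

theorem directionalDeriv_neg (e : V) : directionalDeriv (-e) = (-1 : ℂ) • directionalDeriv e := by
  ext f x
  simp [directionalDeriv]

theorem iteratedDeriv_mul_line (f g : smoothFunctions V) (s t e : V) (n : ℕ) :
    iteratedDeriv n (fun σ : ℝ => (f : V → ℂ) (s + σ • e) * (g : V → ℂ) (t - σ • e)) 0 =
      ∑ k ∈ Finset.range (n + 1), (n.choose k : ℂ) * (((directionalDeriv e) ^ k) f : V → ℂ) s *
        ((-1) ^ (n - k) * (((directionalDeriv e) ^ (n - k)) g : V → ℂ) t) := by
  have hf : ContDiff ℝ n fun σ : ℝ => (f : V → ℂ) (s + σ • e) :=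
    ((contDiff_smoothFunctions f).of_le (by exact_mod_cast le_top)).comp (by fun_prop)
  have hg : ContDiff ℝ n fun σ : ℝ => (g : V → ℂ) (t + σ • (-e)) :=
    ((contDiff_smoothFunctions g).of_le (by exact_mod_cast le_top)).comp (by fun_prop)
  simp_rw [sub_eq_add_neg, ← smul_neg]
  rw [iteratedDeriv_fun_mul hf.contDiffAt hg.contDiffAt]
  refine Finset.sum_congr rfl fun k _ => ?_
  rw [iteratedDeriv_comp_line, iteratedDeriv_comp_line, directionalDeriv_neg, zero_smul, zero_smul,
    add_zero, add_zero]
  congr 1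
  rw [smul_pow]
  simp

/-- The derivative of `exp(-μσ) f(s + σe)` is the same expression for `(D - μ) f`, so each power of
`D - μ` costs one integration of a polynomial. -/
theorem exists_coeff_of_generalized_eigen (e : V) (μ : ℂ) (n : ℕ) (f : smoothFunctions V)
    (h : ((directionalDeriv e - algebraMap ℂ (Module.End ℂ (smoothFunctions V)) μ) ^ n) f = 0)
    (s : V) : ∃ a : ℕ → ℂ, ∀ σ : ℝ, Complex.exp (-(μ * σ)) * (f : V → ℂ) (s + σ • e) =
      ∑ k ∈ Finset.range n, a k * (σ : ℂ) ^ k := by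
  induction n generalizing f with
  | zero =>
    rw [pow_zero, Module.End.one_apply] at h
    exact ⟨0, fun σ => by simp [h]⟩
  | succ n ih =>
    rw [pow_succ, Module.End.mul_apply] at h
    obtain ⟨a, ha⟩ := ih _ h
    set ψ : ℝ → ℂ := fun σ => Complex.exp (-(μ * σ)) * (f : V → ℂ) (s + σ • e) with hψ
    set Q : ℝ → ℂ := fun σ => ∑ k ∈ Finset.range n, a k / (k + 1) * (σ : ℂ) ^ (k + 1) with hQ
    have hψd : ∀ σ : ℝ, HasDerivAt ψ (∑ k ∈ Finset.range n, a k * (σ : ℂ) ^ k) σ := by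
      intro σ
      have h1 : HasDerivAt (fun r : ℝ => Complex.exp (-(μ * r)))
          (Complex.exp (-(μ * σ)) * (-μ)) σ := by
        have h2 : HasDerivAt (fun r : ℝ => -(μ * (r : ℂ))) (-μ) σ := by
          simpa using ((hasDerivAt_id (σ : ℂ)).comp_ofReal.const_mul μ).fun_neg
        exact h2.cexp
      have h3 := h1.mul (hasDerivAt_comp_line f s e σ)
      refine h3.congr_deriv ?_
      rw [← ha σ, LinearMap.sub_apply, Module.algebraMap_end_apply]
      simp only [Submodule.coe_sub, Submodule.coe_smul, Pi.sub_apply, Pi.smul_apply, smul_eq_mul]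
      ring
    have hQd : ∀ σ : ℝ, HasDerivAt Q (∑ k ∈ Finset.range n, a k * (σ : ℂ) ^ k) σ := by
      intro σ
      refine HasDerivAt.fun_sum fun k _ => ?_
      have h1 := ((hasDerivAt_pow (k + 1) (σ : ℂ)).comp_ofReal).const_mul (a k / (k + 1))
      refine h1.congr_deriv ?_
      have : (k + 1 : ℂ) ≠ 0 := by exact_mod_cast k.succ_ne_zero
      rw [add_tsub_cancel_right]
      push_cast
      field_simp
    have hconst : ∀ σ, ψ σ - Q σ = ψ 0 - Q 0 := fun σ =>
      is_const_of_deriv_eq_zero (f := fun σ => ψ σ - Q σ)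
        (fun σ => ((hψd σ).fun_sub (hQd σ)).differentiableAt)
        (fun σ => by simpa using ((hψd σ).fun_sub (hQd σ)).deriv) σ 0
    refine ⟨fun k => Nat.casesOn k (ψ 0) fun k => a k / (k + 1), fun σ => ?_⟩
    rw [Finset.sum_range_succ']
    have hQ0 : Q 0 = 0 := by simp [hQ]
    have := hconst σ
    rw [hQ0, sub_zero, sub_eq_iff_eq_add] at this
    change ψ σ = Q σ + ψ 0 * (σ : ℂ) ^ 0
    rw [this, pow_zero, mul_one, add_comm]

end DirectionalDerivative

/-! ### Functions polynomial along each axis are polynomials -/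

section Interpolation

variable {d : ℕ}

local notation "𝔼" => EuclideanSpace ℝ (Fin d)

/-- Along every line parallel to the `j`-th axis, `P` is a polynomial of degree at most `n`. -/
def PolynomialAlong (n : ℕ) (j : Fin d) (P : 𝔼 → ℂ) : Prop :=
  ∀ s : 𝔼, ∃ a : ℕ → ℂ, ∀ σ : ℝ, P (s + σ • EuclideanSpace.single j 1) =
    ∑ k ∈ Finset.range (n + 1), a k * (σ : ℂ) ^ k

open Polynomial in
theorem PolynomialAlong.eq_interpolate {n : ℕ} {j : Fin d} {P : 𝔼 → ℂ}
    (hP : PolynomialAlong n j P) (s : 𝔼) :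
    P s = ∑ k ∈ Finset.range (n + 1),
      (Lagrange.basis (Finset.range (n + 1)) (fun i : ℕ => (i : ℂ)) k).eval (s j : ℂ) *
        P (s + ((k : ℝ) - s j) • EuclideanSpace.single j 1) := by
  obtain ⟨a, ha⟩ := hP (s - s j • EuclideanSpace.single j 1)
  set r : ℂ[X] := ∑ k ∈ Finset.range (n + 1), C (a k) * X ^ k with hr
  have hre : ∀ z : ℂ, r.eval z = ∑ k ∈ Finset.range (n + 1), a k * z ^ k := fun z => by
    simp [hr, eval_finsetSum]
  have hdeg : r.degree < (Finset.range (n + 1)).card := by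
    rw [Finset.card_range, hr]
    refine (degree_sum_le _ _).trans_lt ((Finset.sup_lt_iff (by exact WithBot.bot_lt_coe _)).2 ?_)
    intro k hk
    exact (degree_C_mul_X_pow_le k (a k)).trans_lt (by exact_mod_cast Finset.mem_range.1 hk)
  have hinterp := Lagrange.eq_interpolate (s := Finset.range (n + 1)) (v := fun i : ℕ => (i : ℂ))
    (Nat.cast_injective.injOn) hdeg
  have h1 : P s = r.eval (s j : ℂ) := by
    rw [hre, ← ha (s j), sub_add_cancel]
  have h2 : ∀ k : ℕ, P (s + ((k : ℝ) - s j) • EuclideanSpace.single j 1) = r.eval (k : ℂ) := by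
    intro k
    rw [hre]
    have := ha k
    rw [Complex.ofReal_natCast] at this
    rw [← this, sub_smul, sub_add_eq_add_sub, add_sub_assoc]
  rw [h1, hinterp, Lagrange.interpolate_apply, eval_finsetSum]
  refine Finset.sum_congr rfl fun k _ => ?_
  rw [eval_mul, eval_C, h2, mul_comm]

/-- Induction on the set `J` of coordinates on which `P` depends: Lagrange interpolation in one
coordinate at the nodes `0, …, n` expresses `P` through its restrictions there, which depend on one
coordinate fewer. -/
theorem exists_mvPolynomial_of_polynomialAlong (n : ℕ) (J : Finset (Fin d)) (P : 𝔼 → ℂ)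
    (hP : ∀ j, PolynomialAlong n j P)
    (hJ : ∀ s s' : 𝔼, (∀ j ∈ J, s j = s' j) → P s = P s') :
    ∃ p : MvPolynomial (Fin d) ℂ, ∀ s : 𝔼,
      P s = MvPolynomial.eval (fun i => ((s i : ℝ) : ℂ)) p := by
  induction J using Finset.induction_on generalizing P with
  | empty => exact ⟨MvPolynomial.C (P 0), fun s => by simpa using hJ s 0 (by simp)⟩
  | insert j₀ J _ ih =>
    set e : 𝔼 := EuclideanSpace.single j₀ 1 with he
    set T : ℕ → 𝔼 → 𝔼 := fun k s => s + ((k : ℝ) - s j₀) • e with hT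
    have hTj : ∀ k s j, T k s j = if j = j₀ then (k : ℝ) else s j := by
      intro k s j
      by_cases h : j = j₀
      · subst h; simp [hT, he]
      · simp [hT, he, h]
    have key : ∀ k : ℕ, ∃ p : MvPolynomial (Fin d) ℂ, ∀ s : 𝔼,
        P (T k s) = MvPolynomial.eval (fun i => ((s i : ℝ) : ℂ)) p := by
      intro k
      refine ih (fun s => P (T k s)) (fun j s => ?_) (fun s s' hss => hJ _ _ fun j hj => ?_)
      · by_cases hj : j = j₀
        · refine ⟨fun i => if i = 0 then P (T k s) else 0, fun σ => ?_⟩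
          have h1 : T k (s + σ • EuclideanSpace.single j 1) = T k s := by
            ext i
            rw [hTj, hTj]
            split_ifs with hi
            · rfl
            · simp [hj, hi]
          simp [h1]
        · obtain ⟨a, ha⟩ := hP j (T k s)
          refine ⟨a, fun σ => ?_⟩
          rw [← ha]
          refine congrArg P (PiLp.ext fun i => ?_)
          rw [hTj, PiLp.add_apply, PiLp.add_apply, hTj]
          split_ifs with hi
          · subst hi
            simp [Ne.symm hj]
          · rfl
      · rw [hTj, hTj]
        split_ifs with hj0
        · rfl
        · exact hss j ((Finset.mem_insert.1 hj).resolve_left hj0)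
    choose p hp using key
    refine ⟨∑ k ∈ Finset.range (n + 1), Polynomial.aeval (MvPolynomial.X j₀)
      (Lagrange.basis (Finset.range (n + 1)) (fun i : ℕ => (i : ℂ)) k) * p k, fun s => ?_⟩
    rw [(hP j₀).eq_interpolate s, map_sum]
    refine Finset.sum_congr rfl fun k _ => ?_
    rw [map_mul, ← hp k s]
    congr 1
    rw [← MvPolynomial.coe_aeval_eq_eval, RingHom.coe_coe, ← Polynomial.aeval_algHom_apply,
      MvPolynomial.aeval_X, Polynomial.coe_aeval_eq_eval]

end Interpolation

/-! ### Assembly of the theorem -/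

section MainTheorem

variable {d : ℕ}

local notation "𝔼" => EuclideanSpace ℝ (Fin d)

theorem exists_mvPolynomial_of_generalized_eigen {f : smoothFunctions 𝔼} {n : ℕ} {μ : Fin d → ℂ}
    (h : ∀ j, ((directionalDeriv (EuclideanSpace.single j 1 : 𝔼) -
      algebraMap ℂ (Module.End ℂ (smoothFunctions 𝔼)) (μ j)) ^ n) f = 0) :
    ∃ p : MvPolynomial (Fin d) ℂ, ∀ s : 𝔼, (f : 𝔼 → ℂ) s =
      MvPolynomial.eval (fun i => ((s i : ℝ) : ℂ)) p * Complex.exp (∑ i, μ i * s i) := by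
  have hF : ∀ j, PolynomialAlong n j
      (fun s : 𝔼 => Complex.exp (-∑ i, μ i * s i) * (f : 𝔼 → ℂ) s) := by
    intro j s
    -- The exponent is raised to `n + 1` to match the `n + 1` coefficients in `PolynomialAlong n`,
    -- also when `n = 0`.
    obtain ⟨a, ha⟩ := exists_coeff_of_generalized_eigen (EuclideanSpace.single j 1) (μ j) (n + 1) f
      (by rw [pow_succ', Module.End.mul_apply, h j, map_zero]) s
    refine ⟨fun k => Complex.exp (-∑ i, μ i * s i) * a k, fun σ => ?_⟩
    have h1 : ∑ i, μ i * (((s + σ • EuclideanSpace.single j 1 : 𝔼) i : ℝ) : ℂ) =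
        ∑ i, μ i * s i + μ j * σ := by
      simp only [PiLp.add_apply, PiLp.smul_apply, Complex.ofReal_add, mul_add,
        Finset.sum_add_distrib]
      congr 1
      rw [Finset.sum_eq_single j]
      · simp
      · intro i _ hi
        simp [hi]
      · simp
    simp_rw [mul_assoc]
    rw [h1, ← Finset.mul_sum, ← ha, neg_add, Complex.exp_add, mul_assoc]
  obtain ⟨p, hp⟩ := exists_mvPolynomial_of_polynomialAlong n Finset.univ _ (fun j => hF j)
    (fun s s' hss => by
      have : s = s' := PiLp.ext fun i => hss i (Finset.mem_univ i)
      rw [this])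
  refine ⟨p, fun s => ?_⟩
  rw [← hp s, mul_right_comm, ← Complex.exp_add, neg_add_cancel, Complex.exp_zero, one_mul]

/-- Completing the square: `Re μ` moves the centre, `Im μ` is the frequency, and the constant
`exp(π‖a‖²)` goes into the polynomial. -/
theorem exp_sum_mul_exp_eq_polyGaussian (p : MvPolynomial (Fin d) ℂ) (μ : Fin d → ℂ) :
    ∃ P : MvPolynomial (Fin d) ℂ, ∀ s : 𝔼,
      MvPolynomial.eval (fun i => ((s i : ℝ) : ℂ)) p * Complex.exp (∑ i, μ i * s i) *
        Complex.exp (-(Real.pi * ‖s‖ ^ 2 : ℝ)) =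
      polyGaussian P (WithLp.toLp 2 fun i => (μ i).im / (2 * Real.pi))
        (WithLp.toLp 2 fun i => (μ i).re / (2 * Real.pi)) s := by
  set w : 𝔼 := WithLp.toLp 2 fun i => (μ i).im / (2 * Real.pi) with hw
  set a : 𝔼 := WithLp.toLp 2 fun i => (μ i).re / (2 * Real.pi) with ha
  have hpi := Real.pi_ne_zero
  refine ⟨MvPolynomial.C (Complex.exp (Real.pi * ‖a‖ ^ 2 : ℝ)) * p, fun s => ?_⟩
  have h1 : ∑ i, μ i * s i = 2 * Real.pi * ⟪s, a⟫_ℝ + 2 * Complex.I * Real.pi * ⟪w, s⟫_ℝ := by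
    rw [PiLp.inner_apply, PiLp.inner_apply]
    push_cast
    rw [Finset.mul_sum, Finset.mul_sum, ← Finset.sum_add_distrib]
    refine Finset.sum_congr rfl fun i _ => ?_
    have hpi' : (Real.pi : ℂ) ≠ 0 := Complex.ofReal_ne_zero.2 hpi
    simp [ha, hw]
    field_simp
    linear_combination (-(s i : ℂ)) * Complex.re_add_im (μ i)
  rw [polyGaussian, map_mul, MvPolynomial.eval_C, h1, norm_sub_sq_real, Complex.ofReal_exp]
  have h2 : Complex.exp (2 * Real.pi * ⟪s, a⟫_ℝ + 2 * Complex.I * Real.pi * ⟪w, s⟫_ℝ) *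
      Complex.exp (-(Real.pi * ‖s‖ ^ 2 : ℝ)) =
      Complex.exp (Real.pi * ‖a‖ ^ 2 : ℝ) *
        Complex.exp (2 * Complex.I * Real.pi * ⟪w, s⟫_ℝ) *
        Complex.exp (-Real.pi * (‖s‖ ^ 2 - 2 * ⟪s, a⟫_ℝ + ‖a‖ ^ 2) : ℝ) := by
    rw [← Complex.exp_add, ← Complex.exp_add, ← Complex.exp_add]
    congr 1
    push_cast
    ring
  rw [mul_assoc, h2]
  ring

theorem contDiff_fourierInv {p : 𝔼 → ℂ} (hp : Measurable p)
    (hp2 : Integrable fun s => ‖p s‖ ^ 2 * Real.exp (‖s‖ ^ 2)) :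
    ContDiff ℝ (⊤ : ℕ∞) (𝓕⁻ p) := by
  have h1 : 𝓕⁻ p = fun x => 𝓕 p (-x) := funext fun x => Real.fourierInv_eq_fourier_neg _ _
  rw [h1]
  refine (Real.contDiff_fourier (N := ⊤) fun n _ => ?_).comp contDiff_neg
  refine ((integrable_norm_mul_exp_of_sq hp.aestronglyMeasurable hp2 1).const_mul
    (n.factorial : ℝ)).mono' (by fun_prop) (.of_forall fun s => ?_)
  rw [Real.norm_of_nonneg (by positivity), one_mul]
  have := Real.pow_div_factorial_le_exp ‖s‖ (norm_nonneg s) n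
  rw [div_le_iff₀ (by positivity)] at this
  nlinarith [norm_nonneg (p s)]

theorem exists_polyGaussian_of_fourierInv {p q : 𝔼 → ℂ} (hp : Measurable p) (hq : Measurable q)
    {K : ℕ}
    (h : Integrable fun z : 𝔼 × 𝔼 => (‖p z.1‖ * ‖q z.2‖) ^ 2 * gaussWeight K ‖z.1 - z.2‖)
    (hp2 : Integrable fun s => ‖p s‖ ^ 2 * Real.exp (‖s‖ ^ 2))
    (hq2 : Integrable fun s => ‖q s‖ ^ 2 * Real.exp (‖s‖ ^ 2))
    (h' : Integrable fun z : 𝔼 × 𝔼 =>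
      (‖𝓕⁻ p z.1‖ * ‖𝓕⁻ q z.2‖) ^ 2 * gaussWeight K ‖z.1 - z.2‖)
    (hp0 : 𝓕⁻ p ≠ 0) (hq0 : 𝓕⁻ q ≠ 0) :
    ∃ a w : 𝔼, ∃ P Q : MvPolynomial (Fin d) ℂ,
      (∀ x, 𝓕⁻ p x = polyGaussian P w a x) ∧ ∀ x, 𝓕⁻ q x = polyGaussian Q w a x := by
  have hpc := contDiff_fourierInv hp hp2
  have hqc := contDiff_fourierInv hq hq2
  have hgauss : ContDiff ℝ (⊤ : ℕ∞) fun s : 𝔼 => Complex.exp (Real.pi * ‖s‖ ^ 2 : ℝ) :=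
    (Complex.ofRealCLM.contDiff.comp (contDiff_const.mul (contDiff_norm_sq ℝ))).cexp
  set f : smoothFunctions 𝔼 := ⟨fun s => 𝓕⁻ p s * Complex.exp (Real.pi * ‖s‖ ^ 2 : ℝ),
    show ContDiff ℝ (⊤ : ℕ∞) _ from hpc.mul hgauss⟩ with hf
  set g : smoothFunctions 𝔼 := ⟨fun s => 𝓕⁻ q s * Complex.exp (Real.pi * ‖s‖ ^ 2 : ℝ),
    show ContDiff ℝ (⊤ : ℕ∞) _ from hqc.mul hgauss⟩ with hg
  have hf0 : f ≠ 0 := by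
    intro hc
    refine hp0 (funext fun s => ?_)
    have := congrFun (congrArg Subtype.val hc) s
    exact (mul_eq_zero.1 this).resolve_right (Complex.exp_ne_zero _)
  have hg0 : g ≠ 0 := by
    intro hc
    refine hq0 (funext fun s => ?_)
    have := congrFun (congrArg Subtype.val hc) s
    exact (mul_eq_zero.1 this).resolve_right (Complex.exp_ne_zero _)
  have key : ∀ j : Fin d, ∃ n : ℕ, ∃ μ : ℂ,
      ((directionalDeriv (EuclideanSpace.single j 1 : 𝔼) -
        algebraMap ℂ (Module.End ℂ (smoothFunctions 𝔼)) μ) ^ n) f = 0 ∧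
      ((directionalDeriv (EuclideanSpace.single j 1 : 𝔼) -
        algebraMap ℂ (Module.End ℂ (smoothFunctions 𝔼)) μ) ^ n) g = 0 := by
    intro j
    set e : 𝔼 := EuclideanSpace.single j 1 with he
    have he1 : ‖e‖ = 1 := by simp [he]
    obtain ⟨n, hn⟩ := hardy_slices hp hq h hp2 hq2 hpc.continuous hqc.continuous h' he1
    refine ⟨n, exists_generalized_eigenvalue (directionalDeriv e) (smoothFunctions 𝔼).subtype
      Subtype.val_injective hf0 hg0 ?_⟩
    set S : 𝔼 × 𝔼 → ℂ := fun z => ∑ k ∈ Finset.range (n + 1), (n.choose k : ℂ) *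
      (((directionalDeriv e) ^ k) f : 𝔼 → ℂ) z.1 *
        ((-1) ^ (n - k) * (((directionalDeriv e) ^ (n - k)) g : 𝔼 → ℂ) z.2) with hS
    have hSc : Continuous S := by
      refine continuous_finsetSum _ fun k _ => ?_
      have h1 := (contDiff_smoothFunctions (((directionalDeriv e) ^ k) f)).continuous
      have h2 := (contDiff_smoothFunctions (((directionalDeriv e) ^ (n - k)) g)).continuous
      fun_prop
    have hSae : S =ᵐ[volume] 0 := by
      filter_upwards [hn] with z hz
      rw [hS]
      dsimp only
      rw [← iteratedDeriv_mul_line]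
      set c : ℝ := ⟪z.1 - z.2, e⟫_ℝ with hc
      -- Along the line, `‖z.1 + σe‖² + ‖z.2 - σe‖²` differs from `(2σ + c)²/2` by a constant, so
      -- the slice of `f ⊗ g` is `κ` times the function in `hardy_slices`.
      set κ : ℂ := Complex.exp (Real.pi * (‖z.1‖ ^ 2 + ‖z.2‖ ^ 2) - Real.pi / 2 * c ^ 2 : ℝ)
      have hprod : (fun σ : ℝ => (f : 𝔼 → ℂ) (z.1 + σ • e) * (g : 𝔼 → ℂ) (z.2 - σ • e)) =
          fun σ : ℝ => κ * (𝓕⁻ p (z.1 + σ • e) * 𝓕⁻ q (z.2 - σ • e) *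
            Complex.exp (Real.pi / 2 * (2 * (σ : ℂ) + (c : ℝ)) ^ 2)) := by
        ext σ
        have h1 : ‖z.1 + σ • e‖ ^ 2 + ‖z.2 - σ • e‖ ^ 2 =
            ‖z.1‖ ^ 2 + ‖z.2‖ ^ 2 + 2 * σ * c + 2 * σ ^ 2 := by
          rw [norm_add_sq_real, norm_sub_sq_real, inner_smul_right, inner_smul_right, norm_smul,
            he1, hc, inner_sub_left, mul_one, Real.norm_eq_abs, sq_abs]
          ring
        have h2 : Complex.exp (Real.pi * ‖z.1 + σ • e‖ ^ 2 : ℝ) *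
            Complex.exp (Real.pi * ‖z.2 - σ • e‖ ^ 2 : ℝ) =
            κ * Complex.exp (Real.pi / 2 * (2 * (σ : ℂ) + (c : ℝ)) ^ 2) := by
          rw [← Complex.exp_add, ← Complex.exp_add, ← Complex.ofReal_add, ← mul_add, h1]
          congr 1
          push_cast
          ring
        change (𝓕⁻ p (z.1 + σ • e) * Complex.exp (Real.pi * ‖z.1 + σ • e‖ ^ 2 : ℝ)) *
          (𝓕⁻ q (z.2 - σ • e) * Complex.exp (Real.pi * ‖z.2 - σ • e‖ ^ 2 : ℝ)) = _
        linear_combination (𝓕⁻ p (z.1 + σ • e) * 𝓕⁻ q (z.2 - σ • e)) * h2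
      rw [hprod, iteratedDeriv_const_mul_field, hz, mul_zero]
      rfl
    -- Continuity upgrades the identity from almost every pair to every pair of points.
    have hS0 : S = 0 := hSc.ae_eq_iff_eq volume continuous_zero |>.1 hSae
    intro s t
    exact congrFun hS0 (s, t)
  choose n μ hnf hng using key
  have hmono : ∀ (x : smoothFunctions 𝔼) (T : Module.End ℂ (smoothFunctions 𝔼)) (m k : ℕ),
      m ≤ k → (T ^ m) x = 0 → (T ^ k) x = 0 := by
    intro x T m k hmk hx
    rw [← Nat.sub_add_cancel hmk, pow_add, Module.End.mul_apply, hx, map_zero]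
  have hle : ∀ j, n j ≤ ∑ i, n i := fun j =>
    Finset.single_le_sum (fun _ _ => Nat.zero_le _) (Finset.mem_univ j)
  -- The sum of the exponents serves as a common exponent for all axes.
  obtain ⟨pf, hpf⟩ := exists_mvPolynomial_of_generalized_eigen (f := f) (n := ∑ i, n i) (μ := μ)
    fun j => hmono _ _ _ _ (hle j) (hnf j)
  obtain ⟨pg, hpg⟩ := exists_mvPolynomial_of_generalized_eigen (f := g) (n := ∑ i, n i) (μ := μ)
    fun j => hmono _ _ _ _ (hle j) (hng j)
  obtain ⟨P, hP⟩ := exp_sum_mul_exp_eq_polyGaussian pf μ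
  obtain ⟨Q, hQ⟩ := exp_sum_mul_exp_eq_polyGaussian pg μ
  refine ⟨WithLp.toLp 2 fun i => (μ i).re / (2 * Real.pi),
    WithLp.toLp 2 fun i => (μ i).im / (2 * Real.pi), P, Q, fun x => ?_, fun x => ?_⟩
  · rw [← hP x, ← hpf x]
    change _ = 𝓕⁻ p x * Complex.exp (Real.pi * ‖x‖ ^ 2 : ℝ) * _
    rw [mul_assoc, ← Complex.exp_add, add_neg_cancel, Complex.exp_zero, mul_one]
  · rw [← hQ x, ← hpg x]
    change _ = 𝓕⁻ q x * Complex.exp (Real.pi * ‖x‖ ^ 2 : ℝ) * _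
    rw [mul_assoc, ← Complex.exp_add, add_neg_cancel, Complex.exp_zero, mul_one]

theorem ofReal_sq_mul_weight_ge {N : ℝ} {K : ℕ} (hK : N ≤ K) (z : ℂ) {r : ℝ} (hr : 0 ≤ r) :
    ‖z‖ₑ ^ 2 * ENNReal.ofReal (gaussWeight K r) ≤
      ENNReal.ofReal (‖z‖ ^ 2 * (Real.exp (Real.pi * r ^ 2) / (1 + r) ^ N)) := by
  rw [ENNReal.ofReal_mul (by positivity), ENNReal.ofReal_pow (norm_nonneg _), ofReal_norm]
  gcongr
  have h1 : 1 ≤ 1 + r := by linarith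
  refine div_le_div_of_nonneg_left (Real.exp_nonneg _) (by positivity) ?_
  rw [← Real.rpow_natCast]
  exact Real.rpow_le_rpow_of_exponent_le h1 hK

theorem exists_polyGaussian_of_measurable {N : ℝ} {u v : 𝔼 → ℂ}
    (hu : MemLp u 2) (hv : MemLp v 2) (hum : Measurable u) (hvm : Measurable v)
    (hu0 : ¬ (u =ᵐ[volume] 0)) (hv0 : ¬ (v =ᵐ[volume] 0))
    (hx : (∫⁻ p : 𝔼 × 𝔼, ENNReal.ofReal (‖radarAmbiguity u v p.1 p.2‖ ^ 2 *
        (Real.exp (Real.pi * ‖p.1‖ ^ 2) / (1 + ‖p.1‖) ^ N))) < ∞)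
    (hy : (∫⁻ p : 𝔼 × 𝔼, ENNReal.ofReal (‖radarAmbiguity u v p.1 p.2‖ ^ 2 *
        (Real.exp (Real.pi * ‖p.2‖ ^ 2) / (1 + ‖p.2‖) ^ N))) < ∞) :
    ∃ a w : 𝔼, ∃ P Q : MvPolynomial (Fin d) ℂ,
      (u =ᵐ[volume] fun x => polyGaussian P w a x) ∧
      (v =ᵐ[volume] fun x => polyGaussian Q w a x) := by
  obtain ⟨K, hK⟩ := exists_nat_ge N
  have hω : Measurable fun x : 𝔼 => ENNReal.ofReal (gaussWeight K ‖x‖) :=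
    ((measurable_gaussWeight K).comp measurable_norm).ennreal_ofReal
  have h1 : ∫⁻ r, ∫⁻ s, ‖u s‖ₑ ^ 2 * ‖v r‖ₑ ^ 2 * ENNReal.ofReal (gaussWeight K ‖s - r‖) < ∞ := by
    rw [← lintegral_radarAmbiguity_weight_left hu hv hum hvm hω]
    exact (lintegral_mono fun p => ofReal_sq_mul_weight_ge hK _ (norm_nonneg _)).trans_lt hx
  have sq_ne : ∀ {h : 𝔼 → ℂ}, ¬ h =ᵐ[volume] 0 → ¬ (fun x => ‖h x‖ₑ ^ 2) =ᵐ[volume] 0 :=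
    fun hh hc => hh (hc.mono fun x hx => by simpa using hx)
  have decay : ∀ {p q : 𝔼 → ℂ}, Measurable p → Measurable q → ¬ p =ᵐ[volume] 0 →
      ¬ q =ᵐ[volume] 0 →
      ∫⁻ r, ∫⁻ s, ‖p s‖ₑ ^ 2 * ‖q r‖ₑ ^ 2 * ENNReal.ofReal (gaussWeight K ‖s - r‖) < ∞ →
      (Integrable fun s => ‖p s‖ ^ 2 * Real.exp (‖s‖ ^ 2)) ∧
        Integrable fun s => ‖q s‖ ^ 2 * Real.exp (‖s‖ ^ 2) := by
    intro p q hp hq hp0 hq0 hpq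
    have hp' := hp.enorm.pow_const 2
    have hq' := hq.enorm.pow_const 2
    refine ⟨integrable_sq_mul_exp_of_lintegral hp
      (lintegral_mul_exp_sq_lt_top hp' hq' hpq (sq_ne hq0)),
      integrable_sq_mul_exp_of_lintegral hq (lintegral_mul_exp_sq_lt_top (K := K) hq' hp' ?_ (sq_ne hp0))⟩
    rwa [lintegral_gaussWeight_symm hp' hq'] at hpq
  have integrable_of : ∀ {p : 𝔼 → ℂ}, Measurable p →
      (Integrable fun s => ‖p s‖ ^ 2 * Real.exp (‖s‖ ^ 2)) → Integrable p := by
    intro p hp hp2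
    have := integrable_norm_mul_exp_of_sq hp.aestronglyMeasurable hp2 0
    simp only [zero_mul, Real.exp_zero, mul_one] at this
    exact (integrable_norm_iff hp.aestronglyMeasurable).1 this
  -- The first condition must be used first: it makes `u, v` integrable, which the formula for the
  -- weight in `y` requires.
  obtain ⟨hu2, hv2⟩ := decay hum hvm hu0 hv0 h1
  have hui := integrable_of hum hu2
  have hvi := integrable_of hvm hv2
  have hpm := (continuous_fourier_of_integrable hui).measurable
  have hqm := (continuous_fourier_of_integrable hvi).measurable
  have h2 : ∫⁻ r, ∫⁻ s, ‖𝓕 u s‖ₑ ^ 2 * ‖𝓕 v r‖ₑ ^ 2 *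
      ENNReal.ofReal (gaussWeight K ‖s - r‖) < ∞ := by
    rw [← lintegral_radarAmbiguity_weight_right hui hvi hum hvm hω]
    exact (lintegral_mono fun p => ofReal_sq_mul_weight_ge hK _ (norm_nonneg _)).trans_lt hy
  have fourier_ne : ∀ {p : 𝔼 → ℂ}, Measurable p → Integrable p → ¬ p =ᵐ[volume] 0 →
      ¬ 𝓕 p =ᵐ[volume] 0 := by
    intro p hp hpi hp0 hc
    have e1 := lintegral_fourier_sq hpi
    rw [lintegral_congr_ae (hc.mono fun x hx => by simp only [hx] :
      (fun x => ‖𝓕 p x‖ₑ ^ 2) =ᵐ[volume] fun x => ‖(0 : 𝔼 → ℂ) x‖ₑ ^ 2)] at e1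
    simp only [Pi.zero_apply, enorm_zero, ne_eq, OfNat.ofNat_ne_zero, not_false_eq_true, zero_pow,
      lintegral_zero] at e1
    exact sq_ne hp0 ((lintegral_eq_zero_iff (hp.enorm.pow_const 2)).1 e1.symm)
  obtain ⟨hp2, hq2⟩ := decay hpm hqm (fourier_ne hum hui hu0) (fourier_ne hvm hvi hv0) h2
  have hu' := ae_eq_fourierInv_fourier hui (integrable_of hpm hp2)
  have hv' := ae_eq_fourierInv_fourier hvi (integrable_of hqm hq2)
  have h1' : Integrable fun z : 𝔼 × 𝔼 =>
      (‖𝓕⁻ (𝓕 u) z.1‖ * ‖𝓕⁻ (𝓕 v) z.2‖) ^ 2 * gaussWeight K ‖z.1 - z.2‖ := by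
    refine (integrable_prod_weight hum hvm h1).congr ?_
    have e1 : ∀ᵐ z : 𝔼 × 𝔼, u z.1 = 𝓕⁻ (𝓕 u) z.1 :=
      Measure.quasiMeasurePreserving_fst.ae hu'
    have e2 : ∀ᵐ z : 𝔼 × 𝔼, v z.2 = 𝓕⁻ (𝓕 v) z.2 :=
      Measure.quasiMeasurePreserving_snd.ae hv'
    filter_upwards [e1, e2] with z hz1 hz2
    rw [hz1, hz2]
  obtain ⟨a, w, P, Q, hP, hQ⟩ := exists_polyGaussian_of_fourierInv hpm hqm
    (integrable_prod_weight hpm hqm h2) hp2 hq2 h1'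
    (fun hc => hu0 (by rwa [hc] at hu')) (fun hc => hv0 (by rwa [hc] at hv'))
  exact ⟨a, w, P, Q, hu'.trans (.of_forall hP), hv'.trans (.of_forall hQ)⟩

end MainTheorem

theorem mainTheorem3 (d : ℕ) (N : ℝ) (u v : EuclideanSpace ℝ (Fin d) → ℂ)
    (hu : MemLp u 2 volume) (hv : MemLp v 2 volume)
    (hu_nonzero : ¬ (u =ᵐ[volume] 0)) (hv_nonzero : ¬ (v =ᵐ[volume] 0))
    (hx : (∫⁻ p : EuclideanSpace ℝ (Fin d) × EuclideanSpace ℝ (Fin d),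
      ENNReal.ofReal (‖radarAmbiguity u v p.1 p.2‖ ^ 2 *
        (Real.exp (Real.pi * ‖p.1‖ ^ 2) / (1 + ‖p.1‖) ^ N))) < ∞)
    (hy : (∫⁻ p : EuclideanSpace ℝ (Fin d) × EuclideanSpace ℝ (Fin d),
      ENNReal.ofReal (‖radarAmbiguity u v p.1 p.2‖ ^ 2 *
        (Real.exp (Real.pi * ‖p.2‖ ^ 2) / (1 + ‖p.2‖) ^ N))) < ∞) :
    ∃ a w : EuclideanSpace ℝ (Fin d), ∃ P Q : MvPolynomial (Fin d) ℂ,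
      (u =ᵐ[volume] fun x => polyGaussian P w a x) ∧
      (v =ᵐ[volume] fun x => polyGaussian Q w a x) := by
  -- The ambiguity function depends only on the classes of `u` and `v`, so measurable
  -- representatives may be taken.
  have eu := hu.1.ae_eq_mk
  have ev := hv.1.ae_eq_mk
  rw [radarAmbiguity_congr_ae eu ev] at hx hy
  obtain ⟨a, w, P, Q, hP, hQ⟩ := exists_polyGaussian_of_measurable (hu.ae_eq eu) (hv.ae_eq ev)
    hu.1.stronglyMeasurable_mk.measurable hv.1.stronglyMeasurable_mk.measurable
    (fun hc => hu_nonzero (eu.trans hc)) (fun hc => hv_nonzero (ev.trans hc)) hx hy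
  exact ⟨a, w, P, Q, eu.trans hP, ev.trans hQ⟩
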